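/- **Notation.** For $n\ge 0$ let $E_n=\{t\in\mathbb R^n: t_j\ge 0,\ \sum_j t_j\le 1\}$, $t_0=1-t_1-\dots-t_n$, and for $b=(b_0,\dots,b_n)$ with positive entries let $\phi_b(t)=\Gamma(b_0+\dots+b_n)\prod_{i=0}^n\Gamma(b_i)^{-1}t_i^{b_i-1}$ be the Dirichlet density on $E_n$. For a real $s\times(n+1)$ matrix $X$ with columns $x^0,\dots,x^n$ let $[X]\subset\mathbb R^s$ be the convex hull of the columns and $Xt=\sum_{i=0}^n t_ix^i$. If $\mathrm{vol}_s([X])>0$ and $d\in\mathbb R_{>0}^{n+1}$, the Dirichlet spline $M(\cdot|d;X)$ is the locally integrable function (unique up to null sets) with $\int_{\mathbb R^s}f(y)M(y|d;X)\,dy=\int_{E_n}f(Xt)\phi_d(t)\,dt$ for all continuous compactly supported $f$. Its moments are $m_\beta(d;X)=\int_{\mathbb R^s}y^\beta M(y|d;X)\,dy$, $\beta\in\mathbb R^s$, where $y^\beta=y_1^{\beta_1}\cdots y_s^{\beta_s}$. For $a\in\mathbb R$ and $z\in\mathbb R^{n+1}$ with positive entries, $R_{-a}(b;z)$ is the Dirichlet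 average $\int_{E_n}\bigl(\sum_{i=0}^n t_iz_i\bigr)^{-a}\phi_b(t)\,dt$ if all $b_i>0$; for other $b$ with $c=b_0+\dots+b_n\ne 0,-1,-2,\dots$ it is defined by analytic continuation in $b$ (over $\{b\in\mathbb C^{n+1}: c\neq 0,-1,-2,\dots\}$). With $(a,0)=1$ and $(a,l)=a(a+1)\cdots(a+l-1)$, Appell's function is $$F_4(\alpha,\beta;\gamma,\delta;\xi,\eta)=\sum_{i,j\ge0}\frac{(\alpha,i+j)(\beta,i+j)}{(\gamma,i)(\delta,j)\,i!\,j!}\,\xi^i\eta^j\qquad(\gamma,\delta\ne0,-1,-2,\dots,\ |\xi|^{1/2}+|\eta|^{1/2}<1),$$ continued real-analytically to the set of all $(\xi,\eta)=(x_1(1-x_2),x_2(1-x_1))$ with $(x_1,x_2)\in\Lambda=\{(x_1,x_2)\in\mathbb R^2: x_1<1,\ x_2<1,\ x_1+x_2<1\}$. **Statement.** Let $(x_1,x_2)\in\Lambda$ be such that $\mathrm{vol}_2([X])>0$, where $$X=\begin{pmatrix}(1-x_1)(1-x_2)&1-x_1-x_2&1-x_1\\ 1-x_2&1-x_2&1\end{pmatrix}.$$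 (i) Let $\alpha,\beta,\gamma,\delta\in\mathbb R$ with $\gamma\ne0,-1,-2,\dots$, let $d=(\gamma+\delta-\alpha-1,\ \alpha+\beta-\gamma-\delta+1,\ \delta-\beta)$ have positive entries (so that $\delta>0$), and let $b=(\beta,\gamma-\beta)\in\mathbb R^2$. Then the integral below converges absolutely and $$F_4(\alpha,\beta;\gamma,\delta;x_1(1-x_2),x_2(1-x_1))=\int_{[X]}M(y|d;X)\,R_{-\alpha}(b;y)\,dy .$$ (ii) Let $\alpha,\beta,\delta\in\mathbb R$ with $\alpha\ne0,-1,-2,\dots$, let $d=(\delta-1,\ \beta-\delta+1,\ \delta-\beta)$ have positive entries, and let $b=(\beta,\alpha-\beta)\in\mathbb R^2$. Then the integral defining $m_{-b}(d;X)$ converges absolutely and $$F_4(\alpha,\beta;\alpha,\delta;x_1(1-x_2),x_2(1-x_1))=m_{-b}(d;X).$$ -/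

import Mathlib

open MeasureTheory
open scoped Matrix

noncomputable section

namespace DirichletSpline

/-- The standard simplex `E_n = {t ∈ ℝⁿ : t_j ≥ 0, t_1 + ⋯ + t_n ≤ 1}`. -/
def simplexE (n : ℕ) : Set (Fin n → ℝ) :=
  {t | (∀ j, 0 ≤ t j) ∧ ∑ j, t j ≤ 1}

/-- The vector `(t_0, t_1, …, t_n)` with `t_0 = 1 - t_1 - ⋯ - t_n`. -/
def bary {n : ℕ} (t : Fin n → ℝ) : Fin (n + 1) → ℝ :=
  Fin.cons (1 - ∑ j, t j) t

/-- The Dirichlet density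
`φ_b(t) = Γ(b_0 + ⋯ + b_n) ∏ᵢ Γ(b_i)⁻¹ t_i ^ (b_i - 1)` on `E_n`. -/
def dirichletDensity {n : ℕ} (b : Fin (n + 1) → ℝ) (t : Fin n → ℝ) : ℝ :=
  Real.Gamma (∑ i, b i) * ∏ i, ((Real.Gamma (b i))⁻¹ * bary t i ^ (b i - 1))

/-- The convex hull `[X]` of the columns `x⁰, …, xⁿ` of an `s × (n+1)` matrix `X`. -/
def hull {s n : ℕ} (X : Matrix (Fin s) (Fin (n + 1)) ℝ) : Set (Fin s → ℝ) :=
  convexHull ℝ (Set.range fun j => fun i => X i j)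

/-- `M` is (a version of) the multivariate Dirichlet spline `M(·|b;X)`: it is locally integrable
and `∫ f(x) M(x) dx = ∫_{E_n} f(Xt) φ_b(t) dt` for all continuous `f` with compact support,
where `Xt = ∑ᵢ t_i xⁱ`. These requirements determine `M` up to a Lebesgue null set. -/
def IsDirichletSpline {s n : ℕ} (b : Fin (n + 1) → ℝ) (X : Matrix (Fin s) (Fin (n + 1)) ℝ)
    (M : (Fin s → ℝ) → ℝ) : Prop :=
  LocallyIntegrable M ∧
    ∀ f : (Fin s → ℝ) → ℝ, Continuous f → HasCompactSupport f →
      ∫ x, f x * M x = ∫ t in simplexE n, f (X *ᵥ bary t) * dirichletDensity b t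

/-- The multivariate Dirichlet spline `M(·|b;X)`. -/
def spline {s n : ℕ} (b : Fin (n + 1) → ℝ) (X : Matrix (Fin s) (Fin (n + 1)) ℝ) :
    (Fin s → ℝ) → ℝ :=
  Classical.epsilon (IsDirichletSpline b X)

/-- The integrand `x ^ β M(x|b;X)` of the moment of the Dirichlet spline, for real exponents
`β ∈ ℝˢ`, with `x ^ β = x_1 ^ β_1 ⋯ x_s ^ β_s`. -/
def momentIntegrand {s n : ℕ} (β : Fin s → ℝ) (b : Fin (n + 1) → ℝ)
    (X : Matrix (Fin s) (Fin (n + 1)) ℝ) (x : Fin s → ℝ) : ℝ :=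
  (∏ i, x i ^ β i) * spline b X x

/-- The moment `m_β(b;X) = ∫ x ^ β M(x|b;X) dx`. -/
def moment {s n : ℕ} (β : Fin s → ℝ) (b : Fin (n + 1) → ℝ)
    (X : Matrix (Fin s) (Fin (n + 1)) ℝ) : ℝ :=
  ∫ x, momentIntegrand β b X x

/-- The single Dirichlet average `H(b;z) = ∫_{E_n} h(∑ᵢ t_i z_i) φ_b(t) dt` for `b` with positive
entries. -/
def dirichletAverage {n : ℕ} (h : ℝ → ℝ) (b z : Fin (n + 1) → ℝ) : ℝ :=
  ∫ t in simplexE n, h (∑ i, bary t i * z i) * dirichletDensity b t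

/-- `G` is the analytic continuation, in the parameters `b`, of the Dirichlet average of
`u ↦ u ^ (-a)` at `z` (with `z_i > 0`): it is holomorphic on the connected open set of all
`b ∈ ℂⁿ⁺¹` with `b_0 + ⋯ + b_n ≠ 0, -1, -2, …`, and it is given by the integral when all the
parameters are real and positive. -/
def IsRContinuation {n : ℕ} (a : ℝ) (z : Fin (n + 1) → ℝ) (G : (Fin (n + 1) → ℂ) → ℂ) : Prop :=
  AnalyticOnNhd ℂ G {b | ∀ m : ℕ, ∑ i, b i ≠ -(m : ℂ)} ∧
    ∀ b : Fin (n + 1) → ℝ, (∀ i, 0 < b i) →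
      G (fun i => (b i : ℂ)) = (dirichletAverage (fun u => u ^ (-a)) b z : ℂ)

/-- `hyperR a b z` is the `R`-hypergeometric function `R_{-a}(b;z)`, the single Dirichlet average
of `u ↦ u ^ (-a)`, for `z` with positive entries and for all real parameters `b` with
`b_0 + ⋯ + b_n ≠ 0, -1, -2, …`. -/
def hyperR {n : ℕ} (a : ℝ) (b z : Fin (n + 1) → ℝ) : ℝ :=
  (Classical.epsilon (IsRContinuation a z) (fun i => (b i : ℂ))).re

/-- The Appell symbol `(a,l) = a (a+1) ⋯ (a+l-1)`. -/
def appellSymbol (a : ℝ) (l : ℕ) : ℝ := ∏ k ∈ Finset.range l, (a + k)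

/-- The general term of the double power series of Appell's function `F_4`. -/
def appellF4Term (α β γ δ X Y : ℝ) (p : ℕ × ℕ) : ℝ :=
  appellSymbol α (p.1 + p.2) * appellSymbol β (p.1 + p.2) /
    (appellSymbol γ p.1 * appellSymbol δ p.2 * (p.1.factorial : ℝ) * (p.2.factorial : ℝ)) *
      X ^ p.1 * Y ^ p.2

/-- The region `Λ = {(x_1,x_2) : x_1 < 1, x_2 < 1, x_1 + x_2 < 1}`. -/
def regionΛ : Set (ℝ × ℝ) := {x | x.1 < 1 ∧ x.2 < 1 ∧ x.1 + x.2 < 1}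

/-- The set of all `(x_1 (1 - x_2), x_2 (1 - x_1))` with `(x_1,x_2) ∈ Λ`. It is connected, contains
the domain `|X|^{1/2} + |Y|^{1/2} < 1` of the `F_4` series, and the map is injective on `Λ`. -/
def domainF4 : Set (ℝ × ℝ) := (fun x => (x.1 * (1 - x.2), x.2 * (1 - x.1))) '' regionΛ

/-- `G` is the analytic continuation of the `F_4` series to `domainF4`. -/
def IsAppellF4 (α β γ δ : ℝ) (G : ℝ × ℝ → ℝ) : Prop :=
  AnalyticOnNhd ℝ G domainF4 ∧
    ∀ X Y : ℝ, √|X| + √|Y| < 1 → HasSum (appellF4Term α β γ δ X Y) (G (X, Y))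

/-- Appell's function `F_4(α,β;γ,δ;X,Y)`: the sum of the double series where
`|X|^{1/2} + |Y|^{1/2} < 1`, continued analytically to `domainF4`. -/
def appellF4 (α β γ δ X Y : ℝ) : ℝ :=
  Classical.epsilon (IsAppellF4 α β γ δ) (X, Y)

/-- The `2 × 3` matrix of knots. -/
def knots (x₁ x₂ : ℝ) : Matrix (Fin 2) (Fin 3) ℝ :=
  !![(1 - x₁) * (1 - x₂), 1 - x₁ - x₂, 1 - x₁;
     1 - x₂, 1 - x₂, 1]

end DirichletSpline

end

noncomputable section

namespace DirichletSpline

open Filter Topology ProbabilityTheory Finset.HasAntidiagonal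

/-! Write s = t₀ and w = t₀ + t₁ for a point t of the triangle `simplexE 2`, and y = Xt. The knots
are arranged so that y₁ = 1 - x₂w and 1 - y₀/y₁ = x₁(1 - x₂s)/(1 - x₂w), with y indexed from 0.
Since R_{-α}(β, γ-β; y) is y₁^(-α) times a Gauss series in 1 - y₀/y₁, for small x it equals the sum
over k of (α)_k(β)_k/((γ)_k k!) x₁^k (1 - x₂s)^k (1 - x₂w)^(-α-k). Expanding in x₂ and integrating
against the Dirichlet density needs only the moments of s^p w^q, which are quotients of rising
factorials (`dirichlet_moment_three`).

On the other side, the F₄ series at (x₁(1-x₂), x₂(1-x₁)) is rearranged in powers of x₁ and x₂. The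
two double series agree coefficient by coefficient: this is the finite identity `appell_coeff`,
proved by repeated Chu–Vandermonde. Hence the formula holds near the origin (`knotAverage_eq_tsum`).

The general case is analytic continuation. On Λ all entries of the knot matrix are positive, so the
integral is real-analytic in (x₁, x₂) (`analyticAt_knotAverage`). The map to the F₄ variables has a
real-analytic inverse, and its image is connected, so the pulled-back integral is the continuation
of F₄ (`isAppellF4_knotAverage`, `appellF4_eq_knotAverage`).

The functions R and F₄ and the spline are chosen by `Classical.epsilon`; each needs existence
together with uniqueness where it is used: a convergent series and the identity theorem for R, the
identity theorem for F₄, and testing against smooth functions for the spline, which is almost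
everywhere the transported Dirichlet density. Part (ii) is the case γ = α, in which R factors into a
product of two powers (`hyperR_self`). -/

/-! ### Rising factorials and the coefficient identity -/

open Finset in
/-- The rising factorial `a (a+1) ⋯ (a+n-1)`. -/
def rising {R : Type*} [CommRing R] (a : R) (n : ℕ) : R := ∏ k ∈ range n, (a + k)

lemma rising_zero {R : Type*} [CommRing R] (a : R) : rising a 0 = 1 := by simp [rising]

lemma rising_succ {R : Type*} [CommRing R] (a : R) (n : ℕ) :
    rising a (n + 1) = rising a n * (a + n) := by
  simp [rising, Finset.prod_range_succ]

lemma rising_add {R : Type*} [CommRing R] (a : R) (m n : ℕ) :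
    rising a (m + n) = rising a m * rising (a + m) n := by
  simp [rising, Finset.prod_range_add, add_assoc]

lemma rising_succ_left {R : Type*} [CommRing R] (a : R) (n : ℕ) :
    rising a (n + 1) = a * rising (a + 1) n := by
  rw [add_comm n 1, rising_add]; simp [rising]

lemma rising_one_left {R : Type*} [CommRing R] (n : ℕ) : rising (1 : R) n = (n.factorial : R) := by
  induction n with
  | zero => simp [rising]
  | succ n ih => rw [rising_succ, ih, Nat.factorial_succ]; push_cast; ring

/-- Chu–Vandermonde for rising factorials. -/
lemma rising_vandermonde {R : Type*} [CommRing R] (a b : R) (n : ℕ) :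
    ∑ p ∈ antidiagonal n, (n.choose p.1 : R) * (rising a p.1 * rising b p.2)
      = rising (a + b) n := by
  induction n with
  | zero => simp [rising]
  | succ n ih =>
    have h := Finset.sum_antidiagonal_choose_succ_mul (R := R)
      (fun i j => rising a i * rising b j) n
    rw [h, rising_succ, ← ih, Finset.sum_mul, ← Finset.sum_add_distrib]
    refine Finset.sum_congr rfl fun p hp => ?_
    have hp' : (n : R) = p.1 + p.2 := by
      rw [← mem_antidiagonal.1 hp]; push_cast; ring
    rw [rising_succ, rising_succ, hp', Nat.choose_symm_of_eq_add (mem_antidiagonal.1 hp).symm]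
    ring

lemma factorial_cast_ne_zero {K : Type*} [Field K] [CharZero K] (n : ℕ) :
    (n.factorial : K) ≠ 0 := Nat.cast_ne_zero.2 n.factorial_ne_zero

lemma choose_div_factorial {K : Type*} [Field K] [CharZero K] {n i j : ℕ} (h : i + j = n) :
    (n.choose i : K) / n.factorial = 1 / (i.factorial * j.factorial) := by
  subst h
  rw [div_eq_div_iff (factorial_cast_ne_zero _)
    (mul_ne_zero (factorial_cast_ne_zero _) (factorial_cast_ne_zero _)), one_mul, ← mul_assoc]
  rw [add_comm i j]
  have := Nat.add_choose_mul_factorial_mul_factorial j i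
  rw [mul_right_comm]
  exact_mod_cast this

lemma rising_vandermonde_div {K : Type*} [Field K] [CharZero K] (a b : K) (n : ℕ) :
    ∑ p ∈ antidiagonal n, (rising a p.1 / p.1.factorial) * (rising b p.2 / p.2.factorial)
      = rising (a + b) n / n.factorial := by
  rw [← rising_vandermonde, Finset.sum_div]
  refine Finset.sum_congr rfl fun p hp => ?_
  rw [mul_div_right_comm, choose_div_factorial (mem_antidiagonal.1 hp)]
  ring

/-- The factors on the left are the negatives of a+k-1, …, a+k-p, that is, of the factors on the
right in reverse order. -/
lemma rising_reflect {R : Type*} [CommRing R] (a : R) {k p : ℕ} (h : p ≤ k) :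
    rising (1 - a - k) p = (-1) ^ p * rising (a + (k - p : ℕ)) p := by
  induction p with
  | zero => simp [rising]
  | succ p ih =>
    rw [rising_succ, ih (by omega), rising_succ_left]
    obtain ⟨l, rfl⟩ := Nat.exists_eq_add_of_le h
    have h1 : p + 1 + l - p = l + 1 := by omega
    have h2 : p + 1 + l - (p + 1) = l := by omega
    rw [h1, h2]; push_cast; ring_nf

lemma sum_range_ite_eq_sum_antidiagonal {R : Type*} [AddCommMonoid R] (f : ℕ → ℕ → R)
    {N k m : ℕ} (hk : N ≤ k) (hm : N ≤ m) :
    ∑ p ∈ Finset.range (k + 1), ∑ q ∈ Finset.range (m + 1), (if p + q ≤ N then f p q else 0)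
      = ∑ r ∈ Finset.range (N + 1), ∑ x ∈ antidiagonal r, f x.1 x.2 := by
  rw [← Finset.sum_product', ← Finset.sum_filter, Finset.sum_sigma']
  refine Finset.sum_bij' (fun x _ => ⟨x.1 + x.2, x⟩) (fun y _ => y.2) ?_ ?_ ?_ ?_ ?_
  · rintro ⟨p, q⟩ h; simp at h ⊢; omega
  · rintro ⟨r, p, q⟩ h; simp at h ⊢; omega
  · simp
  · rintro ⟨r, p, q⟩ h; simp at h ⊢; exact h.2
  · simp

lemma rising_ne_zero {K : Type*} [Field K] {a : K} (h : ∀ n : ℕ, a + n ≠ 0) (n : ℕ) :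
    rising a n ≠ 0 := Finset.prod_ne_zero_iff.2 fun k _ => h k

/-- Product formula for rising factorials, a form of Chu–Vandermonde. -/
lemma sum_rising_mul_choose {K : Type*} [Field K] [CharZero K] (b : K) (k m : ℕ) :
    ∑ r ∈ Finset.range (min k m + 1), (-1) ^ r * rising b (k + m - r) /
      (r.factorial * (m - r).factorial * (k - r).factorial)
      = rising b k * rising b m / (k.factorial * m.factorial) := by
  -- The parameters -m and b + m add up to b, and (-m)_r vanishes for r > m, which cuts the sum off
  -- at `min k m`.
  have h := rising_vandermonde_div (-(m : K)) (b + m) k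
  rw [neg_add_cancel_comm_assoc] at h
  rw [mul_div_mul_comm, ← h, Finset.Nat.sum_antidiagonal_eq_sum_range_succ
    (fun i j => rising (-(m : K)) i / i.factorial * (rising (b + m) j / j.factorial)),
    Finset.sum_mul]
  have hsub : Finset.range (min k m + 1) ⊆ Finset.range (k + 1) := by
    intro x; simp; omega
  rw [← Finset.sum_subset hsub]
  · refine Finset.sum_congr rfl fun r hr => ?_
    have hr' : r ≤ k ∧ r ≤ m := by simp at hr; omega
    have e : k + m - r = m + (k - r) := by omega
    have h2 := rising_reflect (1 : K) hr'.2
    have h3 : rising (1 : K) m = rising 1 (m - r) * rising (1 + ((m - r : ℕ) : K)) r := by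
      rw [← rising_add]; congr 1; omega
    rw [rising_one_left, rising_one_left] at h3
    rw [sub_self, zero_sub] at h2
    rw [h2, e, rising_add, h3]
    have := factorial_cast_ne_zero (K := K) (m - r)
    have : (rising (1 + ((m - r : ℕ) : K)) r) ≠ 0 := by
      intro h0; rw [h0, mul_zero] at h3; exact factorial_cast_ne_zero m h3
    field_simp
  · intro r _ hr
    have : m < r := by simp at *; omega
    have : rising (-(m : K)) r = 0 :=
      Finset.prod_eq_zero (Finset.mem_range.2 this) (by simp)
    simp [this]

/-- By reflection (1-α-g-(k+m))_r is (-1)^r (g+α+k+m-r)_r. Vandermonde splits this over p + q = r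
into (g)_p and (α+k+m-r)_q, and the second factor merges with (α)_{k+m-r} into (α)_{k+m-p}. Then q
occurs only in the β factor and the factorials, and the sum over q is `sum_rising_mul_choose` for β
+ p. -/
lemma appell_coeff_aux {K : Type*} [Field K] [CharZero K] (α β g : K) (hβ : ∀ n : ℕ, β + n ≠ 0)
    (k m : ℕ) :
    ∑ r ∈ Finset.range (min k m + 1), rising α (k + m - r) * rising β (k + m - r) /
      ((m - r).factorial * (k - r).factorial) *
        (rising (1 - α - g - (k + m : ℕ)) r / r.factorial)
      = rising α k * rising β k / k.factorial * ∑ v ∈ antidiagonal m,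
        (k.choose v.1) * (-1) ^ v.1 * (rising (α + k) v.2 / v.2.factorial) *
          (rising β m * rising g v.1 / rising β v.1) := by
  have inner_sum : ∀ r ∈ Finset.range (min k m + 1),
      rising α (k + m - r) * rising β (k + m - r) / ((m - r).factorial * (k - r).factorial) *
        (rising (1 - α - g - (k + m : ℕ)) r / r.factorial)
      = ∑ v ∈ antidiagonal r, (-1) ^ (v.1 + v.2) * rising g v.1 * rising α (k + m - v.1) *
        rising β (k + m - (v.1 + v.2)) / (v.1.factorial * v.2.factorial *
          (m - (v.1 + v.2)).factorial * (k - (v.1 + v.2)).factorial) := by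
    intro r hr
    have hr' : r ≤ k ∧ r ≤ m := by simp at hr; omega
    have h1 := rising_reflect (g + (α + (k + m - r : ℕ))) (le_refl r)
    have h2 : (1 - (g + (α + (k + m - r : ℕ))) - r : K) = 1 - α - g - (k + m : ℕ) := by
      rw [Nat.cast_sub (by omega)]; ring
    rw [h2, Nat.sub_self, Nat.cast_zero, add_zero] at h1
    rw [h1, mul_div_assoc ((-1) ^ r), ← rising_vandermonde_div, Finset.mul_sum, Finset.mul_sum]
    refine Finset.sum_congr rfl fun v hv => ?_
    have hv' := mem_antidiagonal.1 hv
    have h3 : rising α (k + m - v.1) = rising α (k + m - r) * rising (α + (k + m - r : ℕ)) v.2 := by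
      rw [← rising_add]; congr 1; omega
    rw [hv', h3]
    simp only [div_eq_mul_inv, mul_inv]
    ring
  rw [Finset.sum_congr rfl inner_sum, ← sum_range_ite_eq_sum_antidiagonal (fun p q =>
    (-1) ^ (p + q) * rising g p * rising α (k + m - p) * rising β (k + m - (p + q)) /
      (p.factorial * q.factorial * (m - (p + q)).factorial * (k - (p + q)).factorial))
    (min_le_left k m) (min_le_right k m)]
  have outer_sum : ∀ p ∈ Finset.range (k + 1), ∑ q ∈ Finset.range (m + 1),
      (if p + q ≤ min k m then (-1) ^ (p + q) * rising g p * rising α (k + m - p) *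
        rising β (k + m - (p + q)) / (p.factorial * q.factorial * (m - (p + q)).factorial *
          (k - (p + q)).factorial : K) else 0)
      = if p ≤ min k m then (-1) ^ p * rising g p * rising α (k + m - p) / p.factorial *
        (rising β k * rising β m / (rising β p * (k - p).factorial * (m - p).factorial)) else 0 := by
    intro p _
    split_ifs with hp
    · obtain ⟨K, rfl⟩ := Nat.exists_eq_add_of_le (hp.trans (min_le_left k m))
      obtain ⟨M, rfl⟩ := Nat.exists_eq_add_of_le (hp.trans (min_le_right _ m))
      have h := sum_rising_mul_choose (β + p) K M
      have e1 : rising β (p + K) * rising β (p + M) /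
          (rising β p * (p + K - p).factorial * (p + M - p).factorial)
          = rising β p * (rising (β + p) K * rising (β + p) M / (K.factorial * M.factorial)) := by
        rw [rising_add, rising_add, Nat.add_sub_cancel_left, Nat.add_sub_cancel_left]
        have := rising_ne_zero hβ p
        field_simp
      rw [e1, ← h, Finset.mul_sum, Finset.mul_sum, ← Finset.sum_filter]
      have e2 : (Finset.range (p + M + 1)).filter (fun q => p + q ≤ min (p + K) (p + M))
          = Finset.range (min K M + 1) := by
        ext q; simp; omega
      rw [e2]
      refine Finset.sum_congr rfl fun q hq => ?_
      have hq' : q ≤ K ∧ q ≤ M := by simp at hq; omega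
      have i1 : p + M - (p + q) = M - q := by omega
      have i2 : p + K - (p + q) = K - q := by omega
      have i3 : p + K + (p + M) - (p + q) = p + (K + M - q) := by omega
      rw [i1, i2, i3, rising_add β p, pow_add]
      simp only [div_eq_mul_inv, mul_inv]
      ring
    · refine Finset.sum_eq_zero fun q _ => if_neg (by omega)
  rw [Finset.sum_congr rfl outer_sum, ← Finset.sum_filter, Finset.mul_sum,
    Finset.Nat.sum_antidiagonal_eq_sum_range_succ (fun i j => rising α k * rising β k /
      (k.factorial : K) * ((k.choose i) * (-1) ^ i * (rising (α + k) j / j.factorial) *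
          (rising β m * rising g i / rising β i)))]
  have e3 : (Finset.range (k + 1)).filter (fun p => p ≤ min k m)
      = Finset.range (min k m + 1) := by
    ext q; simp only [Finset.mem_filter, Finset.mem_range]; omega
  rw [e3]
  have hsub : Finset.range (min k m + 1) ⊆ Finset.range (m + 1) := by
    intro x; simp only [Finset.mem_range]; omega
  rw [← Finset.sum_subset hsub]
  · refine Finset.sum_congr rfl fun p hp => ?_
    have hp' : p ≤ k ∧ p ≤ m := by simp at hp; omega
    have i1 : k + m - p = k + (m - p) := by omega
    have h4 := choose_div_factorial (K := K) (Nat.add_sub_of_le hp'.1)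
    rw [i1, rising_add]
    have h5 : (k.choose p : K) = 1 / (p.factorial * (k - p).factorial) * k.factorial := by
      rw [← h4, div_mul_cancel₀ _ (factorial_cast_ne_zero k)]
    rw [h5]
    have := factorial_cast_ne_zero (K := K) k
    have := rising_ne_zero hβ p
    field_simp
  · intro p _ hp
    rw [Nat.choose_eq_zero_of_lt (by simp at *; omega)]
    simp

/-- The coefficient of `x₁ ^ k * x₂ ^ m` in `F₄(α, β; γ, δ; x₁ (1 - x₂), x₂ (1 - x₁))`. -/
lemma appell_coeff {K : Type*} [Field K] [CharZero K] (α β γ δ : K) (hβ : ∀ n : ℕ, β + n ≠ 0)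
    (hγ : ∀ n : ℕ, γ + n ≠ 0) (hδ : ∀ n : ℕ, δ + n ≠ 0) (k m : ℕ) :
    ∑ u ∈ antidiagonal k, ∑ v ∈ antidiagonal m,
      rising α (u.2 + v.2) * rising β (u.2 + v.2) /
        (rising γ u.2 * rising δ v.2 * u.2.factorial * v.2.factorial) *
        ((v.2.choose u.1) * (-1) ^ u.1 * ((u.2.choose v.1) * (-1) ^ v.1))
      = rising α k * rising β k / (rising γ k * k.factorial) * ∑ v ∈ antidiagonal m,
        (k.choose v.1) * (-1) ^ v.1 * (rising (α + k) v.2 / v.2.factorial) *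
          (rising β m * rising (γ + δ - α - 1) v.1 / (rising δ m * rising β v.1)) := by
  have h := appell_coeff_aux α β (γ + δ - α - 1) hβ k m
  have hR : rising α k * rising β k / (rising γ k * k.factorial) * ∑ v ∈ antidiagonal m,
        (k.choose v.1) * (-1) ^ v.1 * (rising (α + k) v.2 / v.2.factorial) *
          (rising β m * rising (γ + δ - α - 1) v.1 / (rising δ m * rising β v.1))
      = (rising γ k * rising δ m)⁻¹ * (rising α k * rising β k / k.factorial *
        ∑ v ∈ antidiagonal m,
        (k.choose v.1) * (-1) ^ v.1 * (rising (α + k) v.2 / v.2.factorial) *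
          (rising β m * rising (γ + δ - α - 1) v.1 / rising β v.1)) := by
    rw [Finset.mul_sum, Finset.mul_sum, Finset.mul_sum]
    refine Finset.sum_congr rfl fun v _ => ?_
    simp only [div_eq_mul_inv, mul_inv]
    ring
  rw [hR, ← h, Finset.mul_sum]
  -- With g = γ+δ-α-1 the parameter 1-α-g-(k+m) is (1-γ-k) + (1-δ-m), so Vandermonde separates γ
  -- from δ. After reflection the two factors are, up to sign, (γ)_k/(γ)_{k-p} and (δ)_m/(δ)_{m-q}.
  have step : ∀ r ∈ Finset.range (min k m + 1), (rising γ k * rising δ m)⁻¹ *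
      (rising α (k + m - r) * rising β (k + m - r) / ((m - r).factorial * (k - r).factorial) *
        (rising (1 - α - (γ + δ - α - 1) - (k + m : ℕ)) r / r.factorial))
      = ∑ v ∈ antidiagonal r, (rising γ k * rising δ m)⁻¹ * (rising α (k + m - (v.1 + v.2)) *
        rising β (k + m - (v.1 + v.2)) / ((m - (v.1 + v.2)).factorial *
          (k - (v.1 + v.2)).factorial) * ((rising (1 - γ - k) v.1 / v.1.factorial) *
            (rising (1 - δ - m) v.2 / v.2.factorial))) := by
    intro r _
    have e : (1 - α - (γ + δ - α - 1) - (k + m : ℕ) : K) = (1 - γ - k) + (1 - δ - m) := by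
      push_cast; ring
    rw [e, ← rising_vandermonde_div, Finset.mul_sum, Finset.mul_sum]
    refine Finset.sum_congr rfl fun v hv => ?_
    rw [mem_antidiagonal.1 hv]
  rw [Finset.sum_congr rfl step, ← sum_range_ite_eq_sum_antidiagonal (fun p q =>
    (rising γ k * rising δ m)⁻¹ * (rising α (k + m - (p + q)) *
        rising β (k + m - (p + q)) / ((m - (p + q)).factorial *
          (k - (p + q)).factorial) * ((rising (1 - γ - k) p / p.factorial) *
            (rising (1 - δ - m) q / q.factorial)))) (min_le_left k m) (min_le_right k m),
    Finset.Nat.sum_antidiagonal_eq_sum_range_succ (fun a b => ∑ v ∈ antidiagonal m,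
      rising α (b + v.2) * rising β (b + v.2) /
        (rising γ b * rising δ v.2 * b.factorial * v.2.factorial) *
        ((v.2.choose a) * (-1) ^ a * ((b.choose v.1) * (-1) ^ v.1)))]
  refine Finset.sum_congr rfl fun p hp => ?_
  rw [Finset.Nat.sum_antidiagonal_eq_sum_range_succ (fun c d =>
      rising α (k - p + d) * rising β (k - p + d) /
        (rising γ (k - p) * rising δ d * (k - p).factorial * d.factorial) *
        ((d.choose p) * (-1) ^ p * (((k - p).choose c) * (-1) ^ c)))]
  refine Finset.sum_congr rfl fun q hq => ?_
  have hp' : p ≤ k := by simp at hp; omega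
  have hq' : q ≤ m := by simp at hq; omega
  split_ifs with hpq
  · have hk : p + q ≤ k := hpq.trans (min_le_left _ _)
    have hm : p + q ≤ m := hpq.trans (min_le_right _ _)
    have a1 := choose_div_factorial (K := K) (n := m - q) (i := p) (j := m - (p + q)) (by omega)
    have a2 := choose_div_factorial (K := K) (n := k - p) (i := q) (j := k - (p + q)) (by omega)
    have g1 : rising γ k = rising γ (k - p) * rising (γ + (k - p : ℕ)) p := by
      rw [← rising_add]; congr 1; omega
    have g2 : rising δ m = rising δ (m - q) * rising (δ + (m - q : ℕ)) q := by
      rw [← rising_add]; congr 1; omega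
    have i1 : k - p + (m - q) = k + m - (p + q) := by omega
    have n1 := rising_ne_zero hγ k
    have n2 := rising_ne_zero hδ m
    rw [g1] at n1
    rw [g2] at n2
    rw [rising_reflect γ hp', rising_reflect δ hq', g1, g2, i1]
    have n3 := left_ne_zero_of_mul n1
    have n4 := left_ne_zero_of_mul n2
    have n5 := right_ne_zero_of_mul n1
    have n6 := right_ne_zero_of_mul n2
    calc _ = rising α (k + m - (p + q)) * rising β (k + m - (p + q)) /
        (rising γ (k - p) * rising δ (m - q)) * (-1) ^ p * (-1) ^ q *
        (((m - q).choose p : K) / (m - q).factorial) *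
        (((k - p).choose q : K) / (k - p).factorial) := by
          simp only [div_eq_mul_inv, mul_inv]; ring
      _ = _ := by
          rw [a1, a2]
          field_simp
  · rcases not_le.1 hpq |> min_lt_iff.1 with h' | h'
    · rw [Nat.choose_eq_zero_of_lt (n := k - p) (k := q) (by omega)]; simp
    · rw [Nat.choose_eq_zero_of_lt (n := m - q) (k := p) (by omega)]; simp

/-! ### Geometric growth bounds for rising factorials -/

/-- The ratio bound may fail before `N`; the constant absorbs those terms, and ρ ≥ 1 keeps the bound
valid there. -/
lemma le_mul_pow_of_eventually_le {u : ℕ → ℝ} (hu : ∀ n, 0 ≤ u n) {ρ : ℝ} (hρ : 1 ≤ ρ) {N : ℕ}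
    (h : ∀ n, N ≤ n → u (n + 1) ≤ ρ * u n) (n : ℕ) :
    u n ≤ (∑ k ∈ Finset.range (N + 1), u k) * ρ ^ n := by
  have h0 : 0 ≤ ∑ k ∈ Finset.range (N + 1), u k := Finset.sum_nonneg fun k _ => hu k
  induction n with
  | zero => simpa using Finset.single_le_sum (fun k _ => hu k) (by simp)
  | succ n ih =>
    rcases le_or_gt N n with hn | hn
    · calc u (n + 1) ≤ ρ * u n := h n hn
        _ ≤ ρ * _ := mul_le_mul_of_nonneg_left ih (by linarith)
        _ = _ := by ring
    · calc u (n + 1) ≤ ∑ k ∈ Finset.range (N + 1), u k :=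
            Finset.single_le_sum (f := u) (fun k _ => hu k) (by simp; omega)
        _ ≤ _ := le_mul_of_one_le_right h0 (one_le_pow₀ hρ)

lemma norm_rising_le {𝕜 : Type*} [RCLike 𝕜] (a : 𝕜) {A : ℝ} (hA : ‖a‖ ≤ A) (n : ℕ) :
    ‖rising a n‖ ≤ rising A n := by
  rw [rising, rising, norm_prod]
  refine Finset.prod_le_prod (fun _ _ => norm_nonneg _) fun k _ => ?_
  refine (norm_add_le _ _).trans ?_
  simpa using hA

lemma rising_nonneg {A : ℝ} (hA : 0 ≤ A) (n : ℕ) : 0 ≤ rising A n :=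
  Finset.prod_nonneg fun k _ => by positivity

lemma rising_pos {A : ℝ} (hA : 0 < A) (n : ℕ) : 0 < rising A n :=
  Finset.prod_pos fun k _ => by positivity

lemma ofReal_rising (a : ℝ) (n : ℕ) : ((rising a n : ℝ) : ℂ) = rising (a : ℂ) n := by
  simp [rising]

lemma exists_rising_le {A ρ : ℝ} (hA : 0 ≤ A) (hρ : 1 < ρ) :
    ∃ C, 0 ≤ C ∧ ∀ n, rising A n / n.factorial ≤ C * ρ ^ n := by
  have hu : ∀ n, 0 ≤ rising A n / n.factorial := fun n =>
    div_nonneg (rising_nonneg hA n) (by positivity)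
  -- The ratio of consecutive terms is (A+n)/(n+1), which is at most ρ as soon as A ≤ n(ρ-1).
  obtain ⟨N, hN⟩ := exists_nat_gt (A / (ρ - 1))
  refine ⟨_, Finset.sum_nonneg fun k _ => hu k, le_mul_pow_of_eventually_le hu hρ.le (N := N) ?_⟩
  intro n hn
  rw [rising_succ, Nat.factorial_succ]
  have hn' : A ≤ n * (ρ - 1) := by
    rw [← div_le_iff₀ (by linarith)]
    exact hN.le.trans (by exact_mod_cast hn)
  have : A + n ≤ ρ * (n + 1) := by nlinarith
  have hf : (0 : ℝ) < n.factorial := by positivity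
  push_cast
  rw [div_le_iff₀ (by positivity)]
  have h1 := mul_le_mul_of_nonneg_left this (rising_nonneg hA n)
  calc _ ≤ _ := h1
    _ = _ := by field_simp

/-- Uniformity for c near c₀ is what later gives holomorphy in the parameters of R: the first terms
are controlled by continuity at c₀, the remaining ones by the ratio (n+1)/|c+n|. -/
lemma eventually_factorial_div_rising_le {𝕜 : Type*} [RCLike 𝕜] {c₀ : 𝕜} (hc : ∀ n : ℕ, c₀ + n ≠ 0)
    {ρ : ℝ} (hρ : 1 < ρ) :
    ∃ C, 0 ≤ C ∧ ∀ᶠ c in 𝓝 c₀, ∀ n : ℕ, n.factorial / ‖rising c n‖ ≤ C * ρ ^ n := by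
  set M : ℝ := ‖c₀‖ + 1
  -- For |c| < M < n the ratio is at most (n+1)/(n-M), and this is at most ρ exactly when 1 + ρM ≤
  -- n(ρ-1).
  obtain ⟨N, hN⟩ := exists_nat_gt (max M ((1 + ρ * M) / (ρ - 1)))
  have hcont : ∀ k : ℕ, ContinuousAt (fun c : 𝕜 => (k.factorial : ℝ) / ‖rising c k‖) c₀ := by
    intro k
    refine ContinuousAt.div continuousAt_const ?_ (norm_ne_zero_iff.2 (rising_ne_zero hc k))
    unfold rising
    fun_prop
  have hs : ContinuousAt (fun c : 𝕜 => ∑ k ∈ Finset.range (N + 1), (k.factorial : ℝ) /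
      ‖rising c k‖) c₀ := tendsto_finsetSum _ fun k _ => hcont k
  set S : ℝ := ∑ k ∈ Finset.range (N + 1), (k.factorial : ℝ) / ‖rising c₀ k‖ with hS
  have hS0 : 0 ≤ S := Finset.sum_nonneg fun k _ => by positivity
  refine ⟨S + 1, by positivity, ?_⟩
  have e1 := hs.eventually (eventually_lt_nhds (lt_add_one S))
  have e2 : ∀ᶠ c in 𝓝 c₀, ‖c‖ < M :=
    continuous_norm.continuousAt.eventually (eventually_lt_nhds (lt_add_one _))
  filter_upwards [e1, e2] with c h1 h2 n
  refine (le_mul_pow_of_eventually_le (fun n => by positivity) hρ.le (N := N) ?_ n).trans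
    (mul_le_mul_of_nonneg_right h1.le (by positivity))
  intro n hn
  have hn1 : (N : ℝ) ≤ n := by exact_mod_cast hn
  have hn2 : M < n := ((le_max_left _ _).trans_lt hN).trans_le hn1
  have hn3 : (1 + ρ * M) ≤ n * (ρ - 1) := by
    rw [← div_le_iff₀ (by linarith)]
    exact ((le_max_right _ _).trans hN.le).trans hn1
  have hcn : (n : ℝ) - M ≤ ‖c + n‖ := by
    have := norm_sub_norm_le (n : 𝕜) (-c)
    rw [norm_neg, sub_neg_eq_add, RCLike.norm_natCast, add_comm] at this
    linarith
  have hcn0 : 0 < ‖c + n‖ := by linarith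
  rw [rising_succ, norm_mul, Nat.factorial_succ]
  push_cast
  rw [mul_comm ‖rising c n‖, mul_div_mul_comm]
  refine mul_le_mul_of_nonneg_right ?_ (by positivity)
  rw [div_le_iff₀ hcn0]
  nlinarith

lemma exists_factorial_div_rising_le {𝕜 : Type*} [RCLike 𝕜] {c : 𝕜} (hc : ∀ n : ℕ, c + n ≠ 0)
    {ρ : ℝ} (hρ : 1 < ρ) :
    ∃ C, 0 ≤ C ∧ ∀ n : ℕ, n.factorial / ‖rising c n‖ ≤ C * ρ ^ n := by
  obtain ⟨C, hC, h⟩ := eventually_factorial_div_rising_le hc hρ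
  exact ⟨C, hC, h.self_of_nhds⟩

/-! ### Osgood's lemma and series of holomorphic functions of two variables -/

open BoundedContinuousFunction in
/-- Integration against an integrable weight, as a continuous functional on bounded continuous
functions. -/
def weightedIntegral {T : Type*} [TopologicalSpace T] [MeasurableSpace T]
    [OpensMeasurableSpace T] (μ : Measure T) (h : T → ℂ) (hh : Integrable h μ) : (T →ᵇ ℂ) →L[ℂ] ℂ :=
  have hi : ∀ g : T →ᵇ ℂ, Integrable (fun t => g t * h t) μ := fun g =>
    hh.bdd_mul g.continuous.aestronglyMeasurable (Eventually.of_forall g.norm_coe_le_norm)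
  LinearMap.mkContinuous
    { toFun := fun g => ∫ t, g t * h t ∂μ
      map_add' := fun g₁ g₂ => by
        simp only [coe_add, Pi.add_apply, add_mul]
        exact integral_add (hi g₁) (hi g₂)
      map_smul' := fun c g => by
        simp only [coe_smul, smul_eq_mul, mul_assoc, RingHom.id_apply]
        exact integral_const_mul _ _ }
    (∫ t, ‖h t‖ ∂μ) fun g => by
      refine (norm_integral_le_of_norm_le ((hh.norm).const_mul ‖g‖)
        (Eventually.of_forall fun t => ?_)).trans (by rw [integral_const_mul, mul_comm])
      rw [norm_mul]
      exact mul_le_mul_of_nonneg_right (g.norm_coe_le_norm t) (norm_nonneg _)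

open BoundedContinuousFunction in
lemma weightedIntegral_apply {T : Type*} [TopologicalSpace T] [MeasurableSpace T]
    [OpensMeasurableSpace T] (μ : Measure T) (h : T → ℂ) (hh : Integrable h μ) (g : T →ᵇ ℂ) :
    weightedIntegral μ h hh g = ∫ t, g t * h t ∂μ := rfl

open BoundedContinuousFunction in
lemma isUnit_boundedContinuousFunction {T : Type*} [TopologicalSpace T] (g : T →ᵇ ℂ) {ε : ℝ}
    (hε : 0 < ε) (h : ∀ t, ε ≤ ‖g t‖) : IsUnit g := by
  have h0 : ∀ t, g t ≠ 0 := fun t => norm_pos_iff.1 (hε.trans_le (h t))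
  let k : T →ᵇ ℂ := ofNormedAddCommGroup (fun t => (g t)⁻¹) (g.continuous.inv₀ h0) ε⁻¹ fun t => by
    rw [norm_inv]; exact inv_anti₀ hε (h t)
  exact IsUnit.of_mul_eq_one k (by ext t; exact mul_inv_cancel₀ (h0 t))

open BoundedContinuousFunction in
lemma inverse_boundedContinuousFunction_apply {T : Type*} [TopologicalSpace T] {g : T →ᵇ ℂ}
    (h : IsUnit g) (t : T) : (Ring.inverse g) t = (g t)⁻¹ := by
  refine eq_inv_of_mul_eq_one_left ?_
  have := congrArg (fun k : T →ᵇ ℂ => k t) (Ring.inverse_mul_cancel g h)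
  simpa using this

open BoundedContinuousFunction in
/-- **Osgood's lemma** in two variables. -/
theorem analyticOnNhd_of_separately {U : Set (ℂ × ℂ)} (hU : IsOpen U) {f : ℂ × ℂ → ℂ}
    (hc : ContinuousOn f U) (h1 : ∀ p ∈ U, DifferentiableAt ℂ (fun z => f (z, p.2)) p.1)
    (h2 : ∀ p ∈ U, DifferentiableAt ℂ (fun w => f (p.1, w)) p.2) : AnalyticOnNhd ℂ f U := by
  rintro ⟨a, b⟩ hp
  obtain ⟨r, hr, hrU⟩ : ∃ r > 0, Metric.closedBall a r ×ˢ Metric.closedBall b r ⊆ U := by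
    obtain ⟨ε, hε, h⟩ := Metric.isOpen_iff.1 hU _ hp
    refine ⟨ε / 2, half_pos hε, fun q hq => h ?_⟩
    rw [closedBall_prod_same] at hq
    exact Metric.closedBall_subset_ball (half_lt_self hε) hq
  have hcirc : ∀ (c : ℂ) (θ : ℝ), circleMap c r θ ∈ Metric.closedBall c r := fun c θ =>
    circleMap_mem_closedBall c hr.le θ
  have cauchy1 : ∀ z ∈ Metric.ball a r, ∀ w ∈ Metric.closedBall b r,
      ∮ ζ in C(a, r), (ζ - z)⁻¹ • f (ζ, w) = (2 * Real.pi * Complex.I) • f (z, w) := by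
    intro z hz w hw
    refine Complex.circleIntegral_sub_inv_smul_of_differentiable_on_off_countable
      (s := ∅) (f := fun ζ => f (ζ, w)) (by simp) hz ?_ ?_
    · exact hc.comp (by fun_prop) fun ζ hζ => hrU ⟨hζ, hw⟩
    · intro ζ hζ
      exact h1 (ζ, w) (hrU ⟨Metric.ball_subset_closedBall hζ.1, hw⟩)
  have cauchy2 : ∀ z ∈ Metric.closedBall a r, ∀ w ∈ Metric.ball b r,
      ∮ ω in C(b, r), (ω - w)⁻¹ • f (z, ω) = (2 * Real.pi * Complex.I) • f (z, w) := by
    intro z hz w hw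
    refine Complex.circleIntegral_sub_inv_smul_of_differentiable_on_off_countable
      (s := ∅) (f := fun ω => f (z, ω)) (by simp) hw ?_ ?_
    · exact hc.comp (by fun_prop) fun ω hω => hrU ⟨hz, hω⟩
    · intro ω hω
      exact h2 (z, ω) (hrU ⟨hz, Metric.ball_subset_closedBall hω.1⟩)
  have hcm : ∀ c : ℂ, Continuous (circleMap c r) := fun c => continuous_circleMap c r
  -- The Cauchy kernels are inverses in the Banach algebra of bounded continuous functions of the
  -- two angles. Inversion is analytic on units and integration is a continuous functional, so the
  -- double Cauchy integral is jointly analytic in (z, w).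
  let A : ℝ × ℝ →ᵇ ℂ := ofNormedAddCommGroup (fun x => circleMap a r x.1)
    ((hcm a).comp continuous_fst) (‖a‖ + r) fun x => by
      have := hcirc a x.1
      rw [mem_closedBall_iff_norm] at this
      linarith [norm_le_norm_add_norm_sub' (circleMap a r x.1) a]
  let B : ℝ × ℝ →ᵇ ℂ := ofNormedAddCommGroup (fun x => circleMap b r x.2)
    ((hcm b).comp continuous_snd) (‖b‖ + r) fun x => by
      have := hcirc b x.2
      rw [mem_closedBall_iff_norm] at this
      linarith [norm_le_norm_add_norm_sub' (circleMap b r x.2) b]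
  have hunit : ∀ (c z : ℂ) (θ : ℝ), z ∈ Metric.ball c r →
      r - dist z c ≤ ‖circleMap c r θ - z‖ := by
    intro c z θ hz
    have h1 : ‖circleMap c r θ - c‖ = r := by simp [circleMap, abs_of_pos hr]
    have h2 := norm_sub_le_norm_sub_add_norm_sub (circleMap c r θ) z c
    rw [dist_eq_norm]; linarith
  have evalA : ∀ z x, (A - z • (1 : ℝ × ℝ →ᵇ ℂ)) x = circleMap a r x.1 - z := fun z x => by
    change circleMap a r x.1 - z * 1 = _
    rw [mul_one]
  have evalB : ∀ z x, (B - z • (1 : ℝ × ℝ →ᵇ ℂ)) x = circleMap b r x.2 - z := fun z x => by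
    change circleMap b r x.2 - z * 1 = _
    rw [mul_one]
  have unitA : ∀ z ∈ Metric.ball a r, IsUnit (A - z • (1 : ℝ × ℝ →ᵇ ℂ)) := fun z hz =>
    isUnit_boundedContinuousFunction _ (sub_pos.2 hz) fun x => by
      rw [evalA]; exact hunit a z x.1 hz
  have unitB : ∀ z ∈ Metric.ball b r, IsUnit (B - z • (1 : ℝ × ℝ →ᵇ ℂ)) := fun z hz =>
    isUnit_boundedContinuousFunction _ (sub_pos.2 hz) fun x => by
      rw [evalB]; exact hunit b z x.2 hz
  let S : Set (ℝ × ℝ) := Set.Ioc 0 (2 * Real.pi) ×ˢ Set.Ioc 0 (2 * Real.pi)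
  let h : ℝ × ℝ → ℂ := fun x => deriv (circleMap a r) x.1 * deriv (circleMap b r) x.2 *
    f (circleMap a r x.1, circleMap b r x.2)
  have hcont : Continuous h := by
    have : Continuous fun x : ℝ × ℝ => f (circleMap a r x.1, circleMap b r x.2) :=
      hc.comp_continuous (by fun_prop) fun x => hrU ⟨hcirc a x.1, hcirc b x.2⟩
    simp only [h, deriv_circleMap]
    exact ((((hcm 0).comp continuous_fst).mul continuous_const).mul
      (((hcm 0).comp continuous_snd).mul continuous_const)).mul this
  have hint : ∀ g : ℝ × ℝ → ℂ, Continuous g → IntegrableOn g S := fun g hg =>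
    (hg.continuousOn.integrableOn_compact (isCompact_Icc.prod isCompact_Icc)).mono_set
      (Set.prod_mono Set.Ioc_subset_Icc_self Set.Ioc_subset_Icc_self)
  let L := weightedIntegral (volume.restrict S) h (hint h hcont)
  let G : ℂ × ℂ → ℂ := fun q => (2 * Real.pi * Complex.I)⁻¹ * (2 * Real.pi * Complex.I)⁻¹ *
    L (Ring.inverse (A - q.1 • (1 : ℝ × ℝ →ᵇ ℂ)) * Ring.inverse (B - q.2 • (1 : ℝ × ℝ →ᵇ ℂ)))
  have hG : AnalyticAt ℂ G (a, b) := by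
    refine analyticAt_const.mul ((L.analyticAt _).comp (AnalyticAt.mul ?_ ?_))
    · obtain ⟨u, hu⟩ := unitA a (Metric.mem_ball_self hr)
      refine AnalyticAt.comp (g := Ring.inverse) (by rw [← hu]; exact analyticAt_inverse u) ?_
      exact analyticAt_const.sub (analyticAt_fst.smul analyticAt_const)
    · obtain ⟨u, hu⟩ := unitB b (Metric.mem_ball_self hr)
      refine AnalyticAt.comp (g := Ring.inverse) (by rw [← hu]; exact analyticAt_inverse u) ?_
      exact analyticAt_const.sub (analyticAt_snd.smul analyticAt_const)
  refine hG.congr ?_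
  filter_upwards [prod_mem_nhds (Metric.ball_mem_nhds a hr) (Metric.ball_mem_nhds b hr)]
  rintro ⟨z, w⟩ ⟨hz, hw⟩
  have key : L (Ring.inverse (A - z • (1 : ℝ × ℝ →ᵇ ℂ)) * Ring.inverse (B - w • (1 : ℝ × ℝ →ᵇ ℂ)))
      = ∮ ζ in C(a, r), (ζ - z)⁻¹ • ∮ ω in C(b, r), (ω - w)⁻¹ • f (ζ, ω) := by
    have e : ∀ x : ℝ × ℝ, (Ring.inverse (A - z • (1 : ℝ × ℝ →ᵇ ℂ)) *
        Ring.inverse (B - w • (1 : ℝ × ℝ →ᵇ ℂ))) x * h x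
        = (deriv (circleMap a r) x.1 * (circleMap a r x.1 - z)⁻¹) *
          (deriv (circleMap b r) x.2 * ((circleMap b r x.2 - w)⁻¹ *
            f (circleMap a r x.1, circleMap b r x.2))) := by
      intro x
      rw [mul_apply, inverse_boundedContinuousFunction_apply (unitA z hz),
        inverse_boundedContinuousFunction_apply (unitB w hw)]
      rw [evalA, evalB]
      simp only [h]
      ring
    change ∫ t in S, (Ring.inverse (A - z • (1 : ℝ × ℝ →ᵇ ℂ)) *
        Ring.inverse (B - w • (1 : ℝ × ℝ →ᵇ ℂ))) t * h t = _
    rw [Measure.volume_eq_prod, setIntegral_prod]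
    · rw [circleIntegral, intervalIntegral.integral_of_le (by positivity)]
      refine integral_congr_ae (Eventually.of_forall fun θ => ?_)
      simp only [e, integral_const_mul, smul_eq_mul, circleIntegral]
      rw [intervalIntegral.integral_of_le (by positivity)]
      ring
    · exact hint _ ((BoundedContinuousFunction.continuous _).mul hcont)
  simp only [G]
  rw [key, circleIntegral.integral_congr hr.le
    (g := fun ζ => (2 * Real.pi * Complex.I) • ((ζ - z)⁻¹ • f (ζ, w))) (fun ζ hζ => ?_)]
  · rw [circleIntegral.integral_smul, cauchy1 z hz w (Metric.ball_subset_closedBall hw)]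
    simp only [smul_eq_mul]
    have : (2 * Real.pi * Complex.I : ℂ) ≠ 0 := by simp [Real.pi_ne_zero]
    field_simp
  · simp only
    rw [cauchy2 ζ (Metric.sphere_subset_closedBall hζ) w hw, smul_comm]

/-- The M-test gives joint continuity, Weierstrass's theorem gives holomorphy in each variable
separately, and Osgood's lemma combines them. -/
theorem analyticOnNhd_tsum {U : Set (ℂ × ℂ)} (hU : IsOpen U) {F : ℕ → ℂ × ℂ → ℂ}
    (hF : ∀ n, AnalyticOnNhd ℂ (F n) U)
    (hu : ∀ p ∈ U, ∃ u : ℕ → ℝ, Summable u ∧ ∀ᶠ q in 𝓝 p, ∀ n, ‖F n q‖ ≤ u n) :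
    AnalyticOnNhd ℂ (fun p => ∑' n, F n p) U := by
  intro p hp
  obtain ⟨u, hus, hV⟩ := hu p hp
  obtain ⟨V, hVp, hVo, hpV⟩ := eventually_nhds_iff.1 ((hU.eventually_mem hp).and hV)
  refine analyticOnNhd_of_separately (U := V) hVo ?_ ?_ ?_ p hpV
  · exact continuousOn_tsum (fun n q hq => ((hF n q (hVp q hq).1).continuousAt).continuousWithinAt)
      hus fun n q hq => (hVp q hq).2 n
  · intro q hq
    have ho : IsOpen ((fun z => (z, q.2)) ⁻¹' V) := hVo.preimage (by fun_prop)
    refine (Complex.differentiableOn_tsum_of_summable_norm (F := fun n z => F n (z, q.2)) hus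
      (fun n z hz => ?_) ho fun n z hz => (hVp _ hz).2 n).differentiableAt (ho.mem_nhds hq)
    exact ((hF n _ (hVp _ hz).1).comp₂ (f := fun z => z) (g := fun _ => q.2) analyticAt_id
      analyticAt_const).differentiableAt.differentiableWithinAt
  · intro q hq
    have ho : IsOpen ((fun z => (q.1, z)) ⁻¹' V) := hVo.preimage (by fun_prop)
    refine (Complex.differentiableOn_tsum_of_summable_norm (F := fun n z => F n (q.1, z)) hus
      (fun n z hz => ?_) ho fun n z hz => (hVp _ hz).2 n).differentiableAt (ho.mem_nhds hq)
    exact ((hF n _ (hVp _ hz).1).comp₂ (f := fun _ => q.1) (g := fun z => z) analyticAt_const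
      analyticAt_id).differentiableAt.differentiableWithinAt

/-! ### Binomial series, Beta integrals and Dirichlet moments -/

lemma hasSum_rising_mul_pow (a : ℝ) {u : ℝ} (hu : |u| < 1) :
    HasSum (fun n => rising a n / n.factorial * u ^ n) ((1 - u) ^ (-a)) := by
  have h := Real.one_div_one_sub_rpow_hasFPowerSeriesOnBall_zero a
  have h2 : ∀ n : ℕ, Ring.choose (a + n - 1) n = rising a n / n.factorial := by
    intro n
    rw [eq_div_iff (factorial_cast_ne_zero n), ← Ring.multichoose_eq, mul_comm, ← nsmul_eq_mul,
      Ring.factorial_nsmul_multichoose_eq_ascPochhammer, Polynomial.ascPochhammer_smeval_eq_eval]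
    induction n with
    | zero => simp [rising]
    | succ n ih => rw [ascPochhammer_succ_eval, ih, rising_succ]
  have h3 := h.hasSum (y := u) (by simpa [enorm_eq_nnnorm, ← NNReal.coe_lt_coe] using hu)
  have hu' : 0 ≤ 1 - u := by linarith [le_abs_self u]
  simp only [zero_add, one_div, ← Real.rpow_neg hu', FormalMultilinearSeries.ofScalars_apply_eq,
    h2, smul_eq_mul] at h3
  exact h3

/-- Both claims are read off from the total mass one of the Beta density. -/
lemma integrableOn_beta_and_integral {a b : ℝ} (ha : 0 < a) (hb : 0 < b) :
    IntegrableOn (fun x : ℝ => x ^ (a - 1) * (1 - x) ^ (b - 1)) (Set.Ioo 0 1) ∧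
    ∫ x in Set.Ioo (0 : ℝ) 1, x ^ (a - 1) * (1 - x) ^ (b - 1) = beta a b := by
  have h := lintegral_betaPDF_eq_one ha hb
  rw [lintegral_betaPDF] at h
  have hB := beta_pos ha hb
  have hm : AEStronglyMeasurable (fun x : ℝ => 1 / beta a b * x ^ (a - 1) * (1 - x) ^ (b - 1))
    (volume.restrict (Set.Ioo 0 1)) := Measurable.aestronglyMeasurable (by fun_prop)
  have hn : 0 ≤ᵐ[volume.restrict (Set.Ioo 0 1)]
      (fun x : ℝ => 1 / beta a b * x ^ (a - 1) * (1 - x) ^ (b - 1)) := by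
    refine ae_restrict_of_forall_mem measurableSet_Ioo fun x hx => ?_
    have := hx.1; have := sub_pos.2 hx.2
    simp only [Pi.zero_apply]
    positivity
  have hi : IntegrableOn (fun x : ℝ => 1 / beta a b * x ^ (a - 1) * (1 - x) ^ (b - 1))
      (Set.Ioo 0 1) := ⟨hm, by
    rw [hasFiniteIntegral_iff_ofReal hn, h]; exact ENNReal.one_lt_top⟩
  have hI := integral_eq_lintegral_of_nonneg_ae hn hm
  rw [h, ENNReal.toReal_one] at hI
  constructor
  · have := hi.const_mul (beta a b)
    refine this.congr (Eventually.of_forall fun x => ?_)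
    simp only; field_simp
  · simp_rw [mul_assoc, integral_const_mul] at hI
    field_simp at hI
    exact hI

lemma integrableOn_scaled_beta_and_integral {a b s : ℝ} (ha : 0 < a) (hb : 0 < b) (hs : 0 < s) :
    IntegrableOn (fun x : ℝ => (s - x) ^ (a - 1) * x ^ (b - 1)) (Set.Ioo 0 s) ∧
    ∫ x in Set.Ioo (0 : ℝ) s, (s - x) ^ (a - 1) * x ^ (b - 1) = s ^ (a + b - 1) * beta b a := by
  obtain ⟨h1, h2⟩ := integrableOn_beta_and_integral hb ha
  rw [← integrableOn_Ioc_iff_integrableOn_Ioo,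
    ← intervalIntegrable_iff_integrableOn_Ioc_of_le zero_le_one] at h1
  rw [← integral_Ioc_eq_integral_Ioo, ← intervalIntegral.integral_of_le zero_le_one] at h2
  have hcongr : Set.EqOn (fun x : ℝ => s ^ (a + b - 2) * ((x / s) ^ (b - 1) *
      (1 - x / s) ^ (a - 1))) (fun x => (s - x) ^ (a - 1) * x ^ (b - 1)) (Set.Ioo 0 s) := by
    intro x hx
    have e1 : 1 - x / s = (s - x) / s := by field_simp
    have e2 : s ^ (a + b - 2) = s ^ (a - 1) * s ^ (b - 1) := by
      rw [← Real.rpow_add hs]; ring_nf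
    have := sub_pos.2 hx.2
    simp only
    rw [e1, Real.div_rpow hx.1.le hs.le, Real.div_rpow this.le hs.le, e2]
    have := Real.rpow_pos_of_pos hs (a - 1)
    have := Real.rpow_pos_of_pos hs (b - 1)
    field_simp
  have h3 := h1.comp_mul_right (c := s⁻¹)
  simp only [zero_mul, div_inv_eq_mul, one_mul, ← div_eq_mul_inv] at h3
  constructor
  · refine IntegrableOn.congr_fun ?_ hcongr measurableSet_Ioo
    rw [← integrableOn_Ioc_iff_integrableOn_Ioo,
      ← intervalIntegrable_iff_integrableOn_Ioc_of_le hs.le]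
    exact h3.const_mul _
  · rw [← setIntegral_congr_fun measurableSet_Ioo hcongr, ← integral_Ioc_eq_integral_Ioo,
      ← intervalIntegral.integral_of_le hs.le, intervalIntegral.integral_const_mul,
      intervalIntegral.integral_comp_div (fun x => x ^ (b - 1) * (1 - x) ^ (a - 1)) hs.ne',
      zero_div, div_self hs.ne', h2, smul_eq_mul, ← mul_assoc]
    congr 1
    nth_rewrite 2 [← Real.rpow_one s]
    rw [← Real.rpow_add hs]
    ring_nf

/-- Tonelli: for fixed second coordinate y the inner integral is a Beta integral scaled to (0, 1-y).
It contributes the power (1-y)^(a+b+p+q-1), and the outer integral is again of Beta type. -/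
lemma integrableOn_triangle_and_integral {a b c : ℝ} (ha : 0 < a) (hb : 0 < b) (hc : 0 < c)
    (p q : ℕ) :
    IntegrableOn (fun x : ℝ × ℝ => (1 - x.1 - x.2) ^ p * (1 - x.2) ^ q *
      ((1 - x.1 - x.2) ^ (a - 1) * (x.1 ^ (b - 1) * x.2 ^ (c - 1))))
      {x | 0 ≤ x.1 ∧ 0 ≤ x.2 ∧ x.1 + x.2 ≤ 1} ∧
    ∫ x in {x : ℝ × ℝ | 0 ≤ x.1 ∧ 0 ≤ x.2 ∧ x.1 + x.2 ≤ 1}, (1 - x.1 - x.2) ^ p * (1 - x.2) ^ q *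
      ((1 - x.1 - x.2) ^ (a - 1) * (x.1 ^ (b - 1) * x.2 ^ (c - 1)))
      = beta b (a + p) * beta c (a + b + p + q) := by
  set T : Set (ℝ × ℝ) := {x | 0 ≤ x.1 ∧ 0 ≤ x.2 ∧ x.1 + x.2 ≤ 1} with hT
  set F : ℝ × ℝ → ℝ := fun x => (1 - x.1 - x.2) ^ p * (1 - x.2) ^ q *
      ((1 - x.1 - x.2) ^ (a - 1) * (x.1 ^ (b - 1) * x.2 ^ (c - 1))) with hF
  have hTm : MeasurableSet T := by
    refine (measurableSet_le measurable_const measurable_fst).inter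
      ((measurableSet_le measurable_const measurable_snd).inter
        (measurableSet_le (measurable_fst.add measurable_snd) measurable_const))
  have hFm : Measurable F := by fun_prop
  have hap : 0 < a + p := by positivity
  have hF0 : ∀ x ∈ T, 0 ≤ F x := by
    rintro ⟨x, y⟩ ⟨h1, h2, h3⟩
    simp only at h1 h2 h3
    have h4 : 0 ≤ 1 - x - y := by linarith
    have h5 : 0 ≤ 1 - y := by linarith
    simp only [hF]
    positivity
  have hsec : ∀ y ∈ Set.Ioo (0 : ℝ) 1,
      IntegrableOn (fun x => F (x, y)) (Set.Icc 0 (1 - y)) ∧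
      ∫ x in Set.Icc 0 (1 - y), F (x, y)
        = beta b (a + p) * (y ^ (c - 1) * (1 - y) ^ (a + b + p + q - 1)) := by
    intro y hy
    have hy1 : 0 < 1 - y := sub_pos.2 hy.2
    obtain ⟨i1, i2⟩ := integrableOn_scaled_beta_and_integral hap hb hy1
    have hcongr : Set.EqOn (fun x => ((1 - y) ^ q * y ^ (c - 1)) *
        ((1 - y - x) ^ (a + p - 1) * x ^ (b - 1))) (fun x => F (x, y)) (Set.Ioo 0 (1 - y)) := by
      intro x hx
      have h4 : 0 < 1 - y - x := sub_pos.2 hx.2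
      have h5 : a + p - 1 = p + (a - 1) := by ring
      simp only [hF]
      rw [h5, Real.rpow_add h4, Real.rpow_natCast, sub_right_comm 1 x y]
      ring
    constructor
    · rw [integrableOn_Icc_iff_integrableOn_Ioo]
      exact IntegrableOn.congr_fun (i1.const_mul _) hcongr measurableSet_Ioo
    · rw [integral_Icc_eq_integral_Ioo, ← setIntegral_congr_fun measurableSet_Ioo hcongr,
        integral_const_mul, i2]
      have h6 : a + b + p + q - 1 = q + (a + p + b - 1) := by ring
      rw [h6, Real.rpow_add hy1, Real.rpow_natCast]
      ring
  have hind : ∀ y x : ℝ, T.indicator F (x, y)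
      = (Set.Ici 0).indicator (fun y => (Set.Icc 0 (1 - y)).indicator (fun x => F (x, y)) x) y := by
    intro y x
    by_cases hy : 0 ≤ y
    · rw [Set.indicator_of_mem (s := Set.Ici 0) (Set.mem_Ici.2 hy)]
      by_cases hx : x ∈ Set.Icc 0 (1 - y)
      · rw [Set.indicator_of_mem hx, Set.indicator_of_mem]
        exact ⟨hx.1, hy, by have := hx.2; simp only; linarith⟩
      · rw [Set.indicator_of_notMem hx, Set.indicator_of_notMem]
        exact fun h => hx ⟨h.1, by have := h.2.2; simp only at this; linarith⟩
    · rw [Set.indicator_of_notMem (s := Set.Ici 0) (by simpa using hy), Set.indicator_of_notMem]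
      exact fun h => hy h.2.1
  have hinner : ∀ y : ℝ, y ≠ 0 → y ≠ 1 → Integrable (fun x => T.indicator F (x, y)) ∧
      ∫ x, T.indicator F (x, y) = (Set.Ioo 0 1).indicator (fun y => beta b (a + p) *
        (y ^ (c - 1) * (1 - y) ^ (a + b + p + q - 1))) y := by
    intro y h0 h1
    simp_rw [hind]
    by_cases hy : y ∈ Set.Ioo 0 1
    · simp only [Set.indicator_of_mem (Set.mem_Ici.2 hy.1.le), Set.indicator_of_mem hy]
      rw [integrable_indicator_iff measurableSet_Icc, integral_indicator measurableSet_Icc]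
      exact hsec y hy
    · have hz : ∀ x, (Set.Ici 0).indicator (fun y => (Set.Icc 0 (1 - y)).indicator
          (fun x => F (x, y)) x) y = 0 := by
        intro x
        by_cases h2 : 0 ≤ y
        · have h3 : 1 < y := by
            by_contra h
            exact hy ⟨lt_of_le_of_ne h2 (Ne.symm h0), lt_of_le_of_ne (not_lt.1 h) h1⟩
          rw [Set.indicator_of_mem (Set.mem_Ici.2 h2), Set.Icc_eq_empty (by linarith)]
          simp
        · exact Set.indicator_of_notMem (by simpa using h2) _
      simp only [hz, Set.indicator_of_notMem hy]
      simp
  have hae : ∀ᵐ y : ℝ, y ≠ 0 ∧ y ≠ 1 := by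
    have h := (Set.finite_singleton (1 : ℝ)).insert 0 |>.measure_zero volume
    filter_upwards [compl_mem_ae_iff.2 h] with y hy
    simpa using hy
  obtain ⟨j1, j2⟩ := integrableOn_beta_and_integral hc
    (show 0 < a + b + p + q by positivity)
  have hint : Integrable (T.indicator F) := by
    rw [Measure.volume_eq_prod, integrable_prod_iff' (hFm.indicator hTm).aestronglyMeasurable]
    constructor
    · filter_upwards [hae] with y hy using (hinner y hy.1 hy.2).1
    · have : ∀ x, ‖T.indicator F x‖ = T.indicator F x := fun x =>
        Real.norm_of_nonneg (Set.indicator_nonneg hF0 x)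
      simp_rw [this]
      refine Integrable.congr ?_ (hae.mono fun y hy => (hinner y hy.1 hy.2).2.symm)
      rw [integrable_indicator_iff measurableSet_Ioo]
      exact j1.const_mul _
  refine ⟨(integrable_indicator_iff hTm).1 hint, ?_⟩
  rw [← integral_indicator hTm]
  rw [Measure.volume_eq_prod] at hint ⊢
  rw [integral_prod_symm _ hint, integral_congr_ae (hae.mono fun y hy => (hinner y hy.1 hy.2).2),
    integral_indicator measurableSet_Ioo, integral_const_mul, j2]

lemma Gamma_add_nat {x : ℝ} (hx : 0 < x) (n : ℕ) :
    Real.Gamma (x + n) = rising x n * Real.Gamma x := by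
  induction n with
  | zero => simp [rising]
  | succ n ih =>
    rw [Nat.cast_succ, ← add_assoc, Real.Gamma_add_one (by positivity), ih, rising_succ]
    ring

lemma dirichletDensity_two (b : Fin 2 → ℝ) (t : Fin 1 → ℝ) :
    dirichletDensity b t = Real.Gamma (b 0 + b 1) *
      ((Real.Gamma (b 0))⁻¹ * bary t 0 ^ (b 0 - 1) *
        ((Real.Gamma (b 1))⁻¹ * bary t 1 ^ (b 1 - 1))) :=
  congrArg₂ _ (congrArg _ (Fin.sum_univ_two b)) (Fin.prod_univ_two _)

lemma dirichletDensity_three (d : Fin 3 → ℝ) (t : Fin 2 → ℝ) :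
    dirichletDensity d t = Real.Gamma (d 0 + d 1 + d 2) *
      ((Real.Gamma (d 0))⁻¹ * bary t 0 ^ (d 0 - 1) *
        ((Real.Gamma (d 1))⁻¹ * bary t 1 ^ (d 1 - 1)) *
        ((Real.Gamma (d 2))⁻¹ * bary t 2 ^ (d 2 - 1))) :=
  congrArg₂ _ (congrArg _ (Fin.sum_univ_three d)) (Fin.prod_univ_three _)

/-- In probabilistic terms, t₀+t₁ and t₀/(t₀+t₁) are independent Beta variables, and the integrand
is (t₀+t₁)^(p+q) times the p-th power of the ratio. These monomials suffice because Xt depends on t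
only through t₀ and t₀+t₁. -/
lemma dirichlet_moment_three {d : Fin 3 → ℝ} (hd : ∀ i, 0 < d i) (p q : ℕ) :
    IntegrableOn (fun t => bary t 0 ^ p * (bary t 0 + bary t 1) ^ q * dirichletDensity d t)
      (simplexE 2) ∧
    ∫ t in simplexE 2, bary t 0 ^ p * (bary t 0 + bary t 1) ^ q * dirichletDensity d t
      = rising (d 0 + d 1) (p + q) * rising (d 0) p /
        (rising (d 0 + d 1 + d 2) (p + q) * rising (d 0 + d 1) p) := by
  obtain ⟨h1, h2⟩ := integrableOn_triangle_and_integral (hd 0) (hd 1) (hd 2) p q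
  have mp := volume_preserving_finTwoArrow ℝ
  have hset : simplexE 2 = MeasurableEquiv.finTwoArrow ⁻¹'
      {x : ℝ × ℝ | 0 ≤ x.1 ∧ 0 ≤ x.2 ∧ x.1 + x.2 ≤ 1} := by
    ext t
    simp [simplexE, Fin.forall_fin_two, Fin.sum_univ_two, MeasurableEquiv.finTwoArrow, and_assoc]
  set κ := Real.Gamma (d 0 + d 1 + d 2) * ((Real.Gamma (d 0))⁻¹ * (Real.Gamma (d 1))⁻¹ *
    (Real.Gamma (d 2))⁻¹) with hκ
  have hfun : (fun t => bary t 0 ^ p * (bary t 0 + bary t 1) ^ q * dirichletDensity d t)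
      = (fun x : ℝ × ℝ => κ * ((1 - x.1 - x.2) ^ p * (1 - x.2) ^ q *
      ((1 - x.1 - x.2) ^ (d 0 - 1) * (x.1 ^ (d 1 - 1) * x.2 ^ (d 2 - 1))))) ∘
        MeasurableEquiv.finTwoArrow := by
    ext t
    have e0 : bary t 0 = 1 - t 0 - t 1 := by
      simp [bary, Fin.sum_univ_two]; ring
    have e1 : bary t 1 = t 0 := rfl
    have e2 : bary t 2 = t 1 := rfl
    have e3 : bary t 0 + bary t 1 = 1 - t 1 := by rw [e0, e1]; ring
    simp only [Function.comp, dirichletDensity_three, hκ]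
    rw [e3, e0, e1, e2]
    change _ = Real.Gamma (d 0 + d 1 + d 2) * _ * ((1 - t 0 - t 1) ^ p * (1 - t 1) ^ q *
      ((1 - t 0 - t 1) ^ (d 0 - 1) * (t 0 ^ (d 1 - 1) * t 1 ^ (d 2 - 1))))
    ring
  constructor
  · rw [hfun, hset, mp.integrableOn_comp_preimage (MeasurableEquiv.measurableEmbedding _)]
    exact h1.const_mul _
  · rw [hfun, hset]
    refine (mp.setIntegral_preimage_emb (MeasurableEquiv.measurableEmbedding _)
      (fun x : ℝ × ℝ => κ * ((1 - x.1 - x.2) ^ p * (1 - x.2) ^ q *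
        ((1 - x.1 - x.2) ^ (d 0 - 1) * (x.1 ^ (d 1 - 1) * x.2 ^ (d 2 - 1))))) _).trans ?_
    rw [integral_const_mul, h2, hκ, beta, beta]
    have a0 := hd 0
    have a1 := hd 1
    have a2 := hd 2
    have e1 : d 1 + (d 0 + p) = (d 0 + d 1) + p := by ring
    have e2 : d 0 + d 1 + p + q = (d 0 + d 1) + (p + q : ℕ) := by push_cast; ring
    have e3 : d 2 + (d 0 + d 1 + p + q) = (d 0 + d 1 + d 2) + (p + q : ℕ) := by push_cast; ring
    rw [e3, e2, e1, Gamma_add_nat a0, Gamma_add_nat (by positivity), Gamma_add_nat (by positivity),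
      Gamma_add_nat (by positivity)]
    have g0 := Real.Gamma_pos_of_pos a0
    have g1 := Real.Gamma_pos_of_pos a1
    have g2 := Real.Gamma_pos_of_pos a2
    have g3 := Real.Gamma_pos_of_pos (show 0 < d 0 + d 1 by positivity)
    have g4 := Real.Gamma_pos_of_pos (show 0 < d 0 + d 1 + d 2 by positivity)
    have r1 := rising_pos (show 0 < d 0 + d 1 by positivity) p
    have r2 := rising_pos (show 0 < d 0 + d 1 + d 2 by positivity) (p + q)
    field_simp

lemma dirichlet_moment_two {b : Fin 2 → ℝ} (hb : ∀ i, 0 < b i) (i j : ℕ) :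
    IntegrableOn (fun t => bary t 0 ^ i * bary t 1 ^ j * dirichletDensity b t) (simplexE 1) ∧
    ∫ t in simplexE 1, bary t 0 ^ i * bary t 1 ^ j * dirichletDensity b t
      = rising (b 0) i * rising (b 1) j / rising (b 0 + b 1) (i + j) := by
  have b0 := hb 0
  have b1 := hb 1
  obtain ⟨h1, h2⟩ := integrableOn_beta_and_integral (a := b 1 + j) (b := b 0 + i)
    (by positivity) (by positivity)
  have mp := volume_preserving_funUnique (Fin 1) ℝ
  have hset : simplexE 1 = MeasurableEquiv.funUnique (Fin 1) ℝ ⁻¹' Set.Icc 0 1 := by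
    ext t
    simp [simplexE]
  set κ := Real.Gamma (b 0 + b 1) * ((Real.Gamma (b 0))⁻¹ * (Real.Gamma (b 1))⁻¹) with hκ
  have hfun : (fun t => bary t 0 ^ i * bary t 1 ^ j * dirichletDensity b t)
      = (fun x : ℝ => κ * ((1 - x) ^ i * x ^ j * ((1 - x) ^ (b 0 - 1) * x ^ (b 1 - 1)))) ∘
        MeasurableEquiv.funUnique (Fin 1) ℝ := by
    ext t
    have e0 : bary t 0 = 1 - t 0 := by simp [bary]
    have e1 : bary t 1 = t 0 := rfl
    simp only [Function.comp, dirichletDensity_two, hκ]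
    rw [e0, e1]
    change _ = Real.Gamma (b 0 + b 1) * _ * ((1 - t 0) ^ i * t 0 ^ j *
      ((1 - t 0) ^ (b 0 - 1) * t 0 ^ (b 1 - 1)))
    ring
  have hcongr : Set.EqOn (fun x : ℝ => κ * (x ^ (b 1 + j - 1) * (1 - x) ^ (b 0 + i - 1)))
      (fun x : ℝ => κ * ((1 - x) ^ i * x ^ j * ((1 - x) ^ (b 0 - 1) * x ^ (b 1 - 1))))
      (Set.Ioo 0 1) := by
    intro x hx
    have e1 : b 1 + j - 1 = j + (b 1 - 1) := by ring
    have e0 : b 0 + i - 1 = i + (b 0 - 1) := by ring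
    simp only
    rw [e0, e1, Real.rpow_add hx.1, Real.rpow_add (sub_pos.2 hx.2), Real.rpow_natCast,
      Real.rpow_natCast]
    ring
  constructor
  · rw [hfun, hset]
    refine (mp.integrableOn_comp_preimage (MeasurableEquiv.measurableEmbedding _)).2 ?_
    rw [integrableOn_Icc_iff_integrableOn_Ioo]
    exact IntegrableOn.congr_fun (h1.const_mul _) hcongr measurableSet_Ioo
  · rw [hfun, hset]
    refine (mp.setIntegral_preimage_emb (MeasurableEquiv.measurableEmbedding _)
      (fun x : ℝ => κ * ((1 - x) ^ i * x ^ j * ((1 - x) ^ (b 0 - 1) * x ^ (b 1 - 1)))) _).trans ?_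
    rw [integral_Icc_eq_integral_Ioo, ← setIntegral_congr_fun measurableSet_Ioo hcongr,
      integral_const_mul, h2, hκ, beta]
    have e1 : b 1 + j + (b 0 + i) = (b 0 + b 1) + (i + j : ℕ) := by push_cast; ring
    rw [e1, Gamma_add_nat b0, Gamma_add_nat b1, Gamma_add_nat (by positivity)]
    have g0 := Real.Gamma_pos_of_pos b0
    have g1 := Real.Gamma_pos_of_pos b1
    have g3 := Real.Gamma_pos_of_pos (show 0 < b 0 + b 1 by positivity)
    have r2 := rising_pos (show 0 < b 0 + b 1 by positivity) (i + j)
    field_simp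

/-! ### Elementary facts about the simplex and the density -/

lemma measurableSet_simplexE (n : ℕ) : MeasurableSet (simplexE n) := by
  have h1 : IsClosed {t : Fin n → ℝ | ∀ j, 0 ≤ t j} := by
    simp only [Set.ofPred_forall]
    exact isClosed_iInter fun j => isClosed_le continuous_const (continuous_apply j)
  exact (h1.inter (isClosed_le (continuous_finsetSum _ fun j _ => continuous_apply j)
    continuous_const)).measurableSet

lemma bary_nonneg {n : ℕ} {t : Fin n → ℝ} (ht : t ∈ simplexE n) (i : Fin (n + 1)) :
    0 ≤ bary t i := by
  refine Fin.cases ?_ (fun j => ?_) i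
  · simpa [bary] using ht.2
  · simpa [bary] using ht.1 j

lemma sum_bary {n : ℕ} (t : Fin n → ℝ) : ∑ i, bary t i = 1 := by
  simp [bary, Fin.sum_univ_succ]

lemma bary_le_one {n : ℕ} {t : Fin n → ℝ} (ht : t ∈ simplexE n) (i : Fin (n + 1)) :
    bary t i ≤ 1 := by
  rw [← sum_bary t]
  exact Finset.single_le_sum (fun i _ => bary_nonneg ht i) (Finset.mem_univ i)

@[fun_prop]
lemma continuous_bary {n : ℕ} : Continuous (bary : (Fin n → ℝ) → Fin (n + 1) → ℝ) := by
  refine continuous_pi fun i => Fin.cases ?_ (fun j => ?_) i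
  · simp only [bary, Fin.cons_zero]; fun_prop
  · simp only [bary, Fin.cons_succ]; fun_prop

lemma dirichletDensity_nonneg {n : ℕ} {b : Fin (n + 1) → ℝ} (hb : ∀ i, 0 < b i)
    {t : Fin n → ℝ} (ht : t ∈ simplexE n) : 0 ≤ dirichletDensity b t := by
  refine mul_nonneg (Real.Gamma_pos_of_pos (Finset.sum_pos (fun i _ => hb i) (by simp))).le
    (Finset.prod_nonneg fun i _ => mul_nonneg (inv_nonneg.2 (Real.Gamma_pos_of_pos (hb i)).le)
      (Real.rpow_nonneg (bary_nonneg ht i) _))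

/-! ### The function R: power series, continuation in the parameters, special values -/

/-- The homogeneous part of degree `n` of the double power series of `R_{-a}(b; z)` in
`ξ = 1 - z₀ / l` and `η = 1 - z₁ / l`. -/
def rTerm {K : Type*} [Field K] (a b₀ b₁ ξ η : K) (n : ℕ) : K :=
  rising a n / rising (b₀ + b₁) n * ∑ p ∈ antidiagonal n,
    (rising b₀ p.1 / p.1.factorial) * (rising b₁ p.2 / p.2.factorial) * (ξ ^ p.1 * η ^ p.2)

lemma ofReal_rTerm (a b₀ b₁ ξ η : ℝ) (n : ℕ) :
    ((rTerm a b₀ b₁ ξ η n : ℝ) : ℂ) = rTerm (a : ℂ) b₀ b₁ ξ η n := by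
  simp only [rTerm]
  push_cast [ofReal_rising]
  rfl

/-- Each growth bound for a rising factorial costs a factor r^n; a power of r close to 1 still
leaves a convergent geometric series. -/
lemma exists_one_lt_pow_mul_lt_one {ρ : ℝ} (hρ : ρ < 1) (k : ℕ) : ∃ r : ℝ, 1 < r ∧ r ^ k * ρ < 1 := by
  have hc : ContinuousAt (fun r : ℝ => r ^ k * ρ) 1 := by fun_prop
  have h := hc.eventually (eventually_lt_nhds (b := 1) (by simpa using hρ))
  obtain ⟨r, h1, h2⟩ := ((h.filter_mono nhdsWithin_le_nhds).and
    (self_mem_nhdsWithin : Set.Ioi (1 : ℝ) ∈ 𝓝[>] 1)).exists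
  exact ⟨r, h2, h1⟩

/-- After taking absolute values, the inner sum is a Vandermonde sum for ‖b₀‖ and ‖b₁‖. The factor
n! is inserted so that each quotient has geometric growth of rate near 1. -/
lemma norm_rTerm_le {a b₀ b₁ ξ η : ℂ} {A B ρ : ℝ} (hA : ‖a‖ ≤ A) (hB : ‖b₀‖ + ‖b₁‖ ≤ B)
    (hξ : ‖ξ‖ ≤ ρ) (hη : ‖η‖ ≤ ρ) (n : ℕ) :
    ‖rTerm a b₀ b₁ ξ η n‖ ≤ (rising A n / n.factorial) *
      (n.factorial / ‖rising (b₀ + b₁) n‖) * ((rising B n / n.factorial) * ρ ^ n) := by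
  have hρ : 0 ≤ ρ := (norm_nonneg _).trans hξ
  have hA0 : 0 ≤ A := (norm_nonneg _).trans hA
  have hB0 : 0 ≤ B := (add_nonneg (norm_nonneg _) (norm_nonneg _)).trans hB
  have e : (rising A n / n.factorial) * (n.factorial / ‖rising (b₀ + b₁) n‖)
      = rising A n / ‖rising (b₀ + b₁) n‖ := by
    have : (n.factorial : ℝ) ≠ 0 := factorial_cast_ne_zero n
    field_simp
  rw [rTerm, norm_mul, norm_div, e]
  refine mul_le_mul ?_ ?_ (norm_nonneg _) (div_nonneg (rising_nonneg hA0 n) (norm_nonneg _))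
  · gcongr
    exact norm_rising_le a hA n
  · calc _ ≤ ∑ p ∈ antidiagonal n, (rising ‖b₀‖ p.1 / p.1.factorial) *
          (rising ‖b₁‖ p.2 / p.2.factorial) * ρ ^ n := by
          refine norm_sum_le_of_le _ fun p hp => ?_
          rw [← mem_antidiagonal.1 hp, pow_add]
          simp only [norm_mul, norm_div, norm_pow, RCLike.norm_natCast]
          have := rising_nonneg (norm_nonneg b₀) p.1
          have := rising_nonneg (norm_nonneg b₁) p.2
          gcongr
          · exact norm_rising_le _ le_rfl _
          · exact norm_rising_le _ le_rfl _
      _ = rising (‖b₀‖ + ‖b₁‖) n / n.factorial * ρ ^ n := by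
          rw [← Finset.sum_mul, rising_vandermonde_div]
      _ ≤ _ := by
          gcongr
          refine Finset.prod_le_prod (fun k _ => by positivity) fun k _ => by gcongr

/-- One majorant serves all parameters near (b₀, b₁) and all ξ, η in a closed disc. The first
uniformity gives the continuation in b, the second gives continuity and analyticity in the knots. -/
lemma exists_summable_norm_rTerm_le (a : ℂ) {b₀ b₁ : ℂ} (hc : ∀ m : ℕ, b₀ + b₁ + m ≠ 0) {ρ : ℝ}
    (hρ0 : 0 ≤ ρ) (hρ : ρ < 1) :
    ∃ u : ℕ → ℝ, Summable u ∧ ∀ᶠ q : ℂ × ℂ in 𝓝 (b₀, b₁), ∀ n, ∀ ξ η : ℂ, ‖ξ‖ ≤ ρ → ‖η‖ ≤ ρ →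
      ‖rTerm a q.1 q.2 ξ η n‖ ≤ u n := by
  obtain ⟨r, hr1, hr⟩ := exists_one_lt_pow_mul_lt_one hρ 3
  set B : ℝ := ‖b₀‖ + ‖b₁‖ + 1
  obtain ⟨C₁, hC₁, h₁⟩ := exists_rising_le (norm_nonneg a) hr1
  obtain ⟨C₂, hC₂, h₂⟩ := exists_rising_le (show 0 ≤ B by positivity) hr1
  obtain ⟨C₃, hC₃, h₃⟩ := eventually_factorial_div_rising_le hc hr1
  refine ⟨fun n => C₁ * C₃ * C₂ * (r ^ 3 * ρ) ^ n, (summable_geometric_of_lt_one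
    (by positivity) hr).mul_left _, ?_⟩
  have hcont : ContinuousAt (fun q : ℂ × ℂ => q.1 + q.2) (b₀, b₁) := by fun_prop
  have hcont' : ContinuousAt (fun q : ℂ × ℂ => ‖q.1‖ + ‖q.2‖) (b₀, b₁) := by fun_prop
  filter_upwards [hcont.eventually h₃, hcont'.eventually (eventually_lt_nhds (lt_add_one _))]
    with q hq hqB n ξ η hξ hη
  refine (norm_rTerm_le le_rfl hqB.le hξ hη n).trans ?_
  calc _ ≤ (C₁ * r ^ n) * (C₃ * r ^ n) * ((C₂ * r ^ n) * ρ ^ n) := by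
        have hB0 : 0 ≤ B := by positivity
        have := rising_nonneg (norm_nonneg a) n
        have := rising_nonneg hB0 n
        refine mul_le_mul (mul_le_mul (h₁ n) (hq n) (by positivity) (by positivity)) ?_
          (by positivity) (by positivity)
        exact mul_le_mul_of_nonneg_right (h₂ n) (by positivity)
    _ = _ := by rw [mul_pow]; ring

lemma analyticAt_rising {E : Type*} [NormedAddCommGroup E] [NormedSpace ℂ E] {f : E → ℂ} {x : E}
    (hf : AnalyticAt ℂ f x) (n : ℕ) : AnalyticAt ℂ (fun y => rising (f y) n) x := by
  simp only [rising]
  exact Finset.analyticAt_fun_prod _ fun k _ => hf.add analyticAt_const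

lemma analyticAt_rTerm (a : ℂ) {b₀ b₁ : ℂ} (hc : ∀ m : ℕ, b₀ + b₁ + m ≠ 0) (ξ η : ℂ) (n : ℕ) :
    AnalyticAt ℂ (fun q : ℂ × ℂ => rTerm a q.1 q.2 ξ η n) (b₀, b₁) := by
  simp only [rTerm]
  refine AnalyticAt.mul (analyticAt_const.div (analyticAt_rising
    (analyticAt_fst.add analyticAt_snd) n) (rising_ne_zero hc n)) ?_
  refine Finset.analyticAt_fun_sum _ fun p _ => ?_
  refine AnalyticAt.mul (AnalyticAt.mul ?_ ?_) analyticAt_const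
  · exact (analyticAt_rising analyticAt_fst _).div_const
  · exact (analyticAt_rising analyticAt_snd _).div_const

lemma isOpen_no_pole : IsOpen {q : ℂ × ℂ | ∀ m : ℕ, q.1 + q.2 + m ≠ 0} := by
  rw [isOpen_iff_eventually]
  intro q hq
  obtain ⟨N, hN⟩ := exists_nat_gt ‖q.1 + q.2‖
  have hcont : Continuous fun q : ℂ × ℂ => q.1 + q.2 := by fun_prop
  have h1 : ∀ᶠ p : ℂ × ℂ in 𝓝 q, ‖p.1 + p.2‖ < N :=
    hcont.norm.continuousAt.eventually (eventually_lt_nhds hN)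
  have h2 : ∀ᶠ p : ℂ × ℂ in 𝓝 q, ∀ m ∈ Finset.range N, p.1 + p.2 + m ≠ 0 :=
    (Filter.eventually_all_finset _).2 fun m _ =>
      (hcont.add continuous_const).continuousAt.eventually_ne (hq m)
  filter_upwards [h1, h2] with p hp1 hp2 m hm
  refine hp2 m (Finset.mem_range.2 ?_) hm
  rw [eq_neg_of_add_eq_zero_left hm, norm_neg, Complex.norm_natCast] at hp1
  exact_mod_cast hp1

lemma analyticOnNhd_tsum_rTerm (a : ℂ) {ξ η : ℂ} (hξ : ‖ξ‖ < 1) (hη : ‖η‖ < 1) :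
    AnalyticOnNhd ℂ (fun q : ℂ × ℂ => ∑' n, rTerm a q.1 q.2 ξ η n)
      {q | ∀ m : ℕ, q.1 + q.2 + m ≠ 0} := by
  refine analyticOnNhd_tsum isOpen_no_pole (fun n q hq => analyticAt_rTerm a hq ξ η n) ?_
  intro q hq
  obtain ⟨u, hu, h⟩ := exists_summable_norm_rTerm_le a hq (ρ := max ‖ξ‖ ‖η‖)
    ((norm_nonneg ξ).trans (le_max_left _ _)) (max_lt hξ hη)
  exact ⟨u, hu, h.mono fun q' hq' n => hq' n ξ η (le_max_left _ _) (le_max_right _ _)⟩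

/-- Since t₀ + t₁ = 1, the linear form is l(1 - (t₀ξ + t₁η)); the binomial series is integrated term
by term with the Dirichlet moments. The scale l stays free: l = z₁ yields a Gauss series, while l =
max(z₀, z₁) always converges. -/
lemma dirichletAverage_rpow_two {a : ℝ} {b z : Fin 2 → ℝ} (hb : ∀ i, 0 < b i) {l : ℝ} (hl : 0 < l)
    (h0 : |1 - z 0 / l| < 1) (h1 : |1 - z 1 / l| < 1) :
    dirichletAverage (fun u => u ^ (-a)) b z
      = l ^ (-a) * ∑' n, rTerm a (b 0) (b 1) (1 - z 0 / l) (1 - z 1 / l) n := by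
  set ξ := 1 - z 0 / l with hξ
  set η := 1 - z 1 / l with hη
  set ρ := max |ξ| |η| with hρ
  have hρ0 : 0 ≤ ρ := (abs_nonneg ξ).trans (le_max_left _ _)
  have hρ1 : ρ < 1 := max_lt h0 h1
  have hle : ∀ t ∈ simplexE 1, |bary t 0 * ξ + bary t 1 * η| ≤ ρ := by
    intro t ht
    have t0 := bary_nonneg ht 0
    have t1 := bary_nonneg ht 1
    have hs : bary t 0 + bary t 1 = 1 := (Fin.sum_univ_two _).symm.trans (sum_bary t)
    calc _ ≤ |bary t 0 * ξ| + |bary t 1 * η| := abs_add_le _ _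
      _ = bary t 0 * |ξ| + bary t 1 * |η| := by
        rw [abs_mul, abs_mul, abs_of_nonneg t0, abs_of_nonneg t1]
      _ ≤ bary t 0 * ρ + bary t 1 * ρ := by
        gcongr
        · exact le_max_left _ _
        · exact le_max_right _ _
      _ = ρ := by rw [← add_mul, hs, one_mul]
  let F : ℕ → (Fin 1 → ℝ) → ℝ := fun n t =>
    rising a n / n.factorial * (bary t 0 * ξ + bary t 1 * η) ^ n * dirichletDensity b t
  have hFexp : ∀ n t, F n t = ∑ p ∈ antidiagonal n, rising a n / n.factorial *
      (n.choose p.1 * (ξ ^ p.1 * η ^ p.2)) *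
        (bary t 0 ^ p.1 * bary t 1 ^ p.2 * dirichletDensity b t) := by
    intro n t
    simp only [F]
    rw [(Commute.all _ _).add_pow', Finset.mul_sum, Finset.sum_mul]
    refine Finset.sum_congr rfl fun p _ => ?_
    rw [nsmul_eq_mul, mul_pow, mul_pow]
    ring
  have hFi : ∀ n, IntegrableOn (F n) (simplexE 1) := by
    intro n
    simp_rw [funext (hFexp n)]
    exact integrable_finsetSum _ fun p _ => (dirichlet_moment_two hb p.1 p.2).1.const_mul _
  have hFint : ∀ n, ∫ t in simplexE 1, F n t = rTerm a (b 0) (b 1) ξ η n := by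
    intro n
    simp_rw [hFexp n]
    rw [integral_finsetSum _ fun p _ => (dirichlet_moment_two hb p.1 p.2).1.const_mul _, rTerm,
      Finset.mul_sum]
    refine Finset.sum_congr rfl fun p hp => ?_
    rw [integral_const_mul, (dirichlet_moment_two hb p.1 p.2).2, mem_antidiagonal.1 hp]
    have := choose_div_factorial (K := ℝ) (mem_antidiagonal.1 hp)
    calc _ = rising a n * (n.choose p.1 / n.factorial) * (ξ ^ p.1 * η ^ p.2) *
        (rising (b 0) p.1 * rising (b 1) p.2 / rising (b 0 + b 1) n) := by ring
      _ = _ := by rw [this]; simp only [div_eq_mul_inv, mul_inv]; ring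
  have hD := (dirichlet_moment_two hb 0 0).1
  simp only [pow_zero, mul_one, one_mul] at hD
  have hnorm : ∀ n, ∫ t in simplexE 1, ‖F n t‖
      ≤ |rising a n / n.factorial| * ρ ^ n * ∫ t in simplexE 1, dirichletDensity b t := by
    intro n
    rw [← integral_const_mul]
    refine setIntegral_mono_on (hFi n).norm (hD.const_mul _) (measurableSet_simplexE 1) ?_
    intro t ht
    simp only [F, Real.norm_eq_abs, abs_mul, abs_pow, abs_of_nonneg (dirichletDensity_nonneg hb ht)]
    have := dirichletDensity_nonneg hb ht
    have := hle t ht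
    gcongr
  have hsum : Summable fun n => ∫ t in simplexE 1, ‖F n t‖ := by
    refine Summable.of_nonneg_of_le (fun n => integral_nonneg fun t => norm_nonneg _) hnorm ?_
    refine Summable.mul_right _ ?_
    have := (hasSum_rising_mul_pow a (u := ρ) (by rwa [abs_of_nonneg hρ0])).summable.abs
    simpa [abs_mul, abs_of_nonneg hρ0] using this
  have key := hasSum_integral_of_summable_integral_norm hFi hsum
  simp_rw [hFint] at key
  rw [key.tsum_eq, ← integral_const_mul, dirichletAverage]
  refine setIntegral_congr_fun (measurableSet_simplexE 1) fun t ht => ?_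
  have hu : |bary t 0 * ξ + bary t 1 * η| < 1 := (hle t ht).trans_lt hρ1
  have hs : bary t 0 + bary t 1 = 1 := (Fin.sum_univ_two _).symm.trans (sum_bary t)
  have hz : ∑ i, bary t i * z i = l * (1 - (bary t 0 * ξ + bary t 1 * η)) := by
    rw [show ∑ i, bary t i * z i = bary t 0 * z 0 + bary t 1 * z 1 from Fin.sum_univ_two _, hξ, hη]
    have : bary t 0 = 1 - bary t 1 := by linarith
    rw [this]
    field_simp
    ring
  have hpos : 0 < 1 - (bary t 0 * ξ + bary t 1 * η) := by linarith [(abs_lt.1 hu).2]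
  simp only [hz, F]
  rw [Real.mul_rpow hl.le hpos.le, tsum_mul_right, (hasSum_rising_mul_pow a hu).tsum_eq, mul_assoc]

lemma isRContinuation_tsum_rTerm {a : ℝ} {z : Fin 2 → ℝ} {l : ℝ} (hl : 0 < l)
    (h0 : |1 - z 0 / l| < 1) (h1 : |1 - z 1 / l| < 1) :
    IsRContinuation a z (fun b => ((l ^ (-a) : ℝ) : ℂ) *
      ∑' n, rTerm (a : ℂ) (b 0) (b 1) ((1 - z 0 / l : ℝ) : ℂ) ((1 - z 1 / l : ℝ) : ℂ) n) := by
  refine ⟨?_, ?_⟩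
  · intro b hb
    refine analyticAt_const.mul ?_
    have h := analyticOnNhd_tsum_rTerm (a : ℂ) (ξ := ((1 - z 0 / l : ℝ) : ℂ))
      (η := ((1 - z 1 / l : ℝ) : ℂ)) (by rwa [Complex.norm_real]) (by rwa [Complex.norm_real])
      (b 0, b 1) (fun m h => hb m (by
        rw [show ∑ i, b i = b 0 + b 1 from Fin.sum_univ_two _]; exact eq_neg_of_add_eq_zero_left h))
    exact h.comp₂ (f := fun b : Fin 2 → ℂ => b 0) (g := fun b : Fin 2 → ℂ => b 1)
      ((ContinuousLinearMap.proj (R := ℂ) (φ := fun _ : Fin 2 => ℂ) 0).analyticAt b)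
      ((ContinuousLinearMap.proj (R := ℂ) (φ := fun _ : Fin 2 => ℂ) 1).analyticAt b)
  · intro b hb
    rw [dirichletAverage_rpow_two hb hl h0 h1]
    simp only [← ofReal_rTerm, Complex.ofReal_mul, Complex.ofReal_tsum]

/-- The identity theorem in one variable is enough: fix the first parameter β > 0 and let the second
run through ℂ minus a countable set, which is connected. Real values near 1 supply the accumulating
points of agreement. -/
lemma IsRContinuation.eq_of_pos {a : ℝ} {z : Fin 2 → ℝ} {G₁ G₂ : (Fin 2 → ℂ) → ℂ}
    (h₁ : IsRContinuation a z G₁) (h₂ : IsRContinuation a z G₂) {β w : ℝ} (hβ : 0 < β)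
    (hc : ∀ m : ℕ, β + w ≠ -(m : ℝ)) :
    G₁ ![(β : ℂ), (w : ℂ)] = G₂ ![(β : ℂ), (w : ℂ)] := by
  set U : Set ℂ := {w | ∀ m : ℕ, (β : ℂ) + w ≠ -(m : ℂ)} with hU
  have hUc : U = (Set.range fun m : ℕ => -(m : ℂ) - β)ᶜ := by
    ext w
    simp only [hU, Set.mem_ofPred_eq, Set.mem_compl_iff, Set.mem_range, not_exists]
    refine forall_congr' fun m => not_congr ?_
    rw [sub_eq_iff_eq_add, eq_comm, add_comm]
  have hpre : IsPreconnected U := by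
    rw [hUc]
    exact (Set.Countable.isConnected_compl_of_one_lt_rank (by simp)
      (Set.countable_range _)).isPreconnected
  have hlin : ∀ w : ℂ, AnalyticAt ℂ (fun w : ℂ => (![(β : ℂ), w] : Fin 2 → ℂ)) w := by
    intro w
    refine AnalyticAt.pi fun i => ?_
    fin_cases i
    · exact analyticAt_const
    · exact analyticAt_id
  have han : ∀ {G : (Fin 2 → ℂ) → ℂ}, IsRContinuation a z G →
      AnalyticOnNhd ℂ (fun w => G ![(β : ℂ), w]) U := fun {G} hG w hw =>
    AnalyticAt.comp (g := G) (hG.1 _ fun m => by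
      rw [show ∑ i, (![(β : ℂ), w] : Fin 2 → ℂ) i = β + w from Fin.sum_univ_two _]
      exact hw m) (hlin w)
  have hfreq : ∃ᶠ w : ℂ in 𝓝[≠] ((1 : ℝ) : ℂ), G₁ ![(β : ℂ), w] = G₂ ![(β : ℂ), w] := by
    have ht : Tendsto (fun x : ℝ => (x : ℂ)) (𝓝[≠] 1) (𝓝[≠] ((1 : ℝ) : ℂ)) :=
      tendsto_nhdsWithin_of_tendsto_nhds_of_eventually_within _
        (Complex.continuous_ofReal.continuousAt.tendsto.mono_left nhdsWithin_le_nhds)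
        (eventually_nhdsWithin_of_forall fun x hx => by simpa using hx)
    refine ht.frequently (Eventually.frequently ?_)
    filter_upwards [nhdsWithin_le_nhds (lt_mem_nhds (zero_lt_one' ℝ))] with x hx
    have e : (fun i => ((![β, x] : Fin 2 → ℝ) i : ℂ)) = ![(β : ℂ), (x : ℂ)] := by
      ext i; fin_cases i <;> rfl
    have hpos : ∀ i, 0 < (![β, x] : Fin 2 → ℝ) i := by
      intro i; fin_cases i
      · exact hβ
      · exact hx
    rw [← e, h₁.2 _ hpos, h₂.2 _ hpos]
  refine AnalyticOnNhd.eqOn_of_preconnected_of_frequently_eq (han h₁) (han h₂) hpre ?_ hfreq ?_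
  · intro m h
    have : (β + 1 : ℝ) = -(m : ℝ) := by exact_mod_cast h
    have : (0 : ℝ) ≤ m := m.cast_nonneg
    linarith
  · intro m h
    exact hc m (by exact_mod_cast h)

/-- The series is itself a continuation, so the function chosen by `Classical.epsilon` is one too,
and uniqueness evaluates it. -/
theorem hyperR_eq_tsum {a : ℝ} {z : Fin 2 → ℝ} {l : ℝ} (hl : 0 < l)
    (h0 : |1 - z 0 / l| < 1) (h1 : |1 - z 1 / l| < 1) {β w : ℝ} (hβ : 0 < β)
    (hc : ∀ m : ℕ, β + w ≠ -(m : ℝ)) :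
    hyperR a ![β, w] z = l ^ (-a) * ∑' n, rTerm a β w (1 - z 0 / l) (1 - z 1 / l) n := by
  have hG := isRContinuation_tsum_rTerm (a := a) hl h0 h1
  have hE : IsRContinuation a z (Classical.epsilon (IsRContinuation a z)) :=
    Classical.epsilon_spec ⟨_, hG⟩
  have e : (fun i => ((![β, w] : Fin 2 → ℝ) i : ℂ)) = ![(β : ℂ), (w : ℂ)] := by
    ext i; fin_cases i <;> rfl
  have h := hE.eq_of_pos hG hβ hc
  rw [hyperR, e, h, ← Complex.ofReal_re (l ^ (-a) * _)]
  simp only [← ofReal_rTerm, Complex.ofReal_mul, Complex.ofReal_tsum, Matrix.cons_val_zero,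
    Matrix.cons_val_one]

/-- With l = z₁ one has η = 0, so only the index (n, 0) survives in each homogeneous part and the
Gauss series remains. -/
theorem hyperR_eq_tsum_of_abs_lt {a : ℝ} {z : Fin 2 → ℝ} (hz : 0 < z 1)
    (h0 : |1 - z 0 / z 1| < 1) {β w : ℝ} (hβ : 0 < β) (hc : ∀ m : ℕ, β + w ≠ -(m : ℝ)) :
    hyperR a ![β, w] z = z 1 ^ (-a) * ∑' n, rising a n * rising β n /
      (rising (β + w) n * n.factorial) * (1 - z 0 / z 1) ^ n := by
  rw [hyperR_eq_tsum hz h0 (by simp [div_self hz.ne']) hβ hc]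
  congr 1
  refine tsum_congr fun n => ?_
  rw [rTerm, Finset.sum_eq_single (n, 0)]
  · simp only [rising_zero]
    simp only [div_eq_mul_inv, mul_inv]
    simp
    ring
  · rintro ⟨i, j⟩ hp hne
    have : j ≠ 0 := by
      rintro rfl
      rw [mem_antidiagonal] at hp
      simp only [add_zero] at hp
      exact hne (by rw [hp])
    simp [div_self hz.ne', this]
  · simp

/-- For a = β + w the quotient of rising factorials in front of each homogeneous part is 1, so the
double series is the Cauchy product of two binomial series. Taking l as the larger of z₀, z₁ puts
both arguments in [0, 1), and the powers of l cancel. -/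
theorem hyperR_self {a : ℝ} {z : Fin 2 → ℝ} (hz0 : 0 < z 0) (hz1 : 0 < z 1) {β w : ℝ} (hβ : 0 < β)
    (ha : a = β + w) (hc : ∀ m : ℕ, a ≠ -(m : ℝ)) :
    hyperR a ![β, w] z = z 0 ^ (-β) * z 1 ^ (-w) := by
  subst ha
  set l := max (z 0) (z 1) with hl'
  have hl : 0 < l := lt_max_of_lt_left hz0
  have h0 : |1 - z 0 / l| < 1 := by
    have := div_pos hz0 hl
    have := (div_le_one hl).2 (le_max_left (z 0) (z 1))
    rw [abs_lt]; constructor <;> linarith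
  have h1 : |1 - z 1 / l| < 1 := by
    have := div_pos hz1 hl
    have := (div_le_one hl).2 (le_max_right (z 0) (z 1))
    rw [abs_lt]; constructor <;> linarith
  rw [hyperR_eq_tsum hl h0 h1 hβ hc]
  have s0 := hasSum_rising_mul_pow β h0
  have s1 := hasSum_rising_mul_pow w h1
  have hm := tsum_mul_tsum_eq_tsum_sum_antidiagonal_of_summable_norm s0.summable.norm
    s1.summable.norm
  rw [s0.tsum_eq, s1.tsum_eq] at hm
  have hterm : ∀ n, rTerm (β + w) β w (1 - z 0 / l) (1 - z 1 / l) n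
      = ∑ p ∈ antidiagonal n, rising β p.1 / p.1.factorial * (1 - z 0 / l) ^ p.1 *
        (rising w p.2 / p.2.factorial * (1 - z 1 / l) ^ p.2) := by
    intro n
    rw [rTerm, div_self (rising_ne_zero (fun m h => hc m (eq_neg_of_add_eq_zero_left h)) n),
      one_mul]
    exact Finset.sum_congr rfl fun p _ => by ring
  simp_rw [hterm]
  rw [← hm, sub_sub_cancel, sub_sub_cancel, Real.div_rpow hz0.le hl.le, Real.div_rpow hz1.le hl.le,
    neg_add, Real.rpow_add hl]
  have := Real.rpow_pos_of_pos hl (-β)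
  have := Real.rpow_pos_of_pos hl (-w)
  field_simp

/-! ### Regrouping of sums and the F₄ series -/

lemma HasSum.sum_antidiagonal {f : ℕ × ℕ → ℝ} {s : ℝ} (h : HasSum f s) :
    HasSum (fun n => ∑ p ∈ antidiagonal n, f p) s := by
  have h' := h.tsum_fiberwise (fun p => p.1 + p.2)
  refine Eq.mp (congrArg (fun g => HasSum g s) (funext fun n => ?_)) h'
  have : (fun p : ℕ × ℕ => p.1 + p.2) ⁻¹' {n} = ↑(antidiagonal n) := by
    ext p; simp [mem_antidiagonal]
  rw [this, Finset.tsum_subtype']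

lemma HasSum.sum_antidiagonal_right {f : ℕ × (ℕ × ℕ) → ℝ} {s : ℝ} (h : HasSum f s) :
    HasSum (fun x : ℕ × ℕ => ∑ v ∈ antidiagonal x.2, f (x.1, v)) s := by
  have h' := h.tsum_fiberwise (fun x => (x.1, x.2.1 + x.2.2))
  refine Eq.mp (congrArg (fun g => HasSum g s) (funext fun x => ?_)) h'
  have : (fun x : ℕ × (ℕ × ℕ) => (x.1, x.2.1 + x.2.2)) ⁻¹' {x}
      = ↑(({x.1} : Finset ℕ) ×ˢ antidiagonal x.2) := by
    ext ⟨k, v⟩; simp [mem_antidiagonal, Prod.ext_iff, and_comm, eq_comm]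
  rw [this, Finset.tsum_subtype', Finset.sum_product, Finset.sum_singleton]

lemma HasSum.sum_antidiagonal_prod {f : (ℕ × ℕ) × (ℕ × ℕ) → ℝ} {s : ℝ} (h : HasSum f s) :
    HasSum (fun x : ℕ × ℕ => ∑ u ∈ antidiagonal x.1, ∑ v ∈ antidiagonal x.2, f (u, v)) s := by
  have h' := h.tsum_fiberwise (fun x => (x.1.1 + x.1.2, x.2.1 + x.2.2))
  refine Eq.mp (congrArg (fun g => HasSum g s) (funext fun x => ?_)) h'
  have : (fun x : (ℕ × ℕ) × (ℕ × ℕ) => (x.1.1 + x.1.2, x.2.1 + x.2.2)) ⁻¹' {x}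
      = ↑(antidiagonal x.1 ×ˢ antidiagonal x.2) := by
    ext ⟨k, v⟩; simp [mem_antidiagonal, Prod.ext_iff]
  rw [this, Finset.tsum_subtype', Finset.sum_product]

lemma summable_of_summable_sum_antidiagonal {f : ℕ × ℕ → ℝ} (hf : ∀ p, 0 ≤ f p)
    (h : Summable fun n => ∑ p ∈ antidiagonal n, f p) : Summable f := by
  rw [← Finset.HasAntidiagonal.sigmaAntidiagonalEquivProd.summable_iff]
  refine (summable_sigma_of_nonneg fun x => hf _).2 ⟨fun n => (hasSum_fintype _).summable, ?_⟩
  refine h.congr fun n => ?_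
  rw [tsum_fintype]
  exact (Finset.sum_coe_sort (antidiagonal n) f).symm

lemma sum_antidiagonal_choose_mul_pow (u v : ℝ) (n : ℕ) :
    ∑ p ∈ antidiagonal n, n.choose p.1 * (u ^ p.1 * v ^ p.2) = (u + v) ^ n := by
  rw [(Commute.all u v).add_pow']
  simp only [nsmul_eq_mul]

/-- The coefficients of Appell's function `F₄`. -/
def appellCoeff (α β γ δ : ℝ) (i j : ℕ) : ℝ :=
  rising α (i + j) * rising β (i + j) / (rising γ i * rising δ j * i.factorial * j.factorial)

lemma appellF4Term_eq (α β γ δ X Y : ℝ) (p : ℕ × ℕ) :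
    appellF4Term α β γ δ X Y p = appellCoeff α β γ δ p.1 p.2 * (X ^ p.1 * Y ^ p.2) :=
  mul_assoc _ _ _

/-- Up to factors r^n the coefficient has size C(N,i)² with N = i + j. One copy of C(N,i)√X^i√Y^j is
at most (√X+√Y)^N, and the other sums to (√X+√Y)^N over i + j = N, which leaves a geometric series
with ratio near (√X+√Y)². -/
lemma summable_appellCoeff {α β γ δ X Y : ℝ} (hγ : ∀ m : ℕ, γ + m ≠ 0) (hδ : ∀ m : ℕ, δ + m ≠ 0)
    (hX : 0 ≤ X) (hY : 0 ≤ Y) (h : √X + √Y < 1) :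
    Summable fun p : ℕ × ℕ => |appellCoeff α β γ δ p.1 p.2| * (X ^ p.1 * Y ^ p.2) := by
  obtain ⟨r, hr1, hr⟩ := exists_one_lt_pow_mul_lt_one (ρ := (√X + √Y) ^ 2)
    (pow_lt_one₀ (by positivity) h two_ne_zero) 3
  obtain ⟨C₁, hC₁, h₁⟩ := exists_rising_le (abs_nonneg α) hr1
  obtain ⟨C₂, hC₂, h₂⟩ := exists_rising_le (abs_nonneg β) hr1
  obtain ⟨C₃, hC₃, h₃⟩ := exists_factorial_div_rising_le hγ hr1
  obtain ⟨C₄, hC₄, h₄⟩ := exists_factorial_div_rising_le hδ hr1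
  set C := C₁ * C₂ * C₃ * C₄ with hC
  set s := √X + √Y with hs
  refine Summable.of_nonneg_of_le (fun p => by positivity)
    (f := fun p : ℕ × ℕ => C * (r ^ 3 * s) ^ (p.1 + p.2) *
      ((p.1 + p.2).choose p.1 * (√X ^ p.1 * √Y ^ p.2))) (fun p => ?_) ?_
  · obtain ⟨i, j⟩ := p
    simp only
    set N := i + j with hN
    have hch := choose_div_factorial (K := ℝ) hN.symm
    have fN := factorial_cast_ne_zero (K := ℝ) N
    have hch' : (N.factorial : ℝ) / (i.factorial * j.factorial) = N.choose i := by
      rw [div_eq_mul_one_div, ← hch]; field_simp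
    have e1 : |appellCoeff α β γ δ i j| = (|rising α N| / N.factorial) *
        (|rising β N| / N.factorial) * (i.factorial / ‖rising γ i‖) *
        (j.factorial / ‖rising δ j‖) * (N.choose i * N.choose i) := by
      rw [← hch', appellCoeff, ← hN]
      simp only [abs_div, abs_mul, Nat.abs_cast, Real.norm_eq_abs]
      have := factorial_cast_ne_zero (K := ℝ) i
      have := factorial_cast_ne_zero (K := ℝ) j
      field_simp
    have e2 : X ^ i * Y ^ j = (√X ^ i * √Y ^ j) * (√X ^ i * √Y ^ j) := by
      nth_rewrite 1 [← Real.mul_self_sqrt hX]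
      nth_rewrite 1 [← Real.mul_self_sqrt hY]
      ring
    have e3 : N.choose i * (√X ^ i * √Y ^ j) ≤ s ^ N := by
      rw [hs, ← sum_antidiagonal_choose_mul_pow]
      exact Finset.single_le_sum (f := fun p : ℕ × ℕ => (N.choose p.1 : ℝ) * (√X ^ p.1 * √Y ^ p.2))
        (fun p _ => by positivity) ((mem_antidiagonal (a := (i, j))).2 hN.symm)
    have e4 : |rising α N| / N.factorial ≤ C₁ * r ^ N :=
      (div_le_div_of_nonneg_right (norm_rising_le α le_rfl N) (by positivity)).trans (h₁ N)
    have e5 : |rising β N| / N.factorial ≤ C₂ * r ^ N :=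
      (div_le_div_of_nonneg_right (norm_rising_le β le_rfl N) (by positivity)).trans (h₂ N)
    calc |appellCoeff α β γ δ i j| * (X ^ i * Y ^ j)
        = (|rising α N| / N.factorial) * (|rising β N| / N.factorial) *
          (i.factorial / ‖rising γ i‖) * (j.factorial / ‖rising δ j‖) *
          ((N.choose i * (√X ^ i * √Y ^ j)) * (N.choose i * (√X ^ i * √Y ^ j))) := by
          rw [e1, e2]; ring
      _ ≤ (C₁ * r ^ N) * (C₂ * r ^ N) * (C₃ * r ^ i) * (C₄ * r ^ j) *
          (s ^ N * (N.choose i * (√X ^ i * √Y ^ j))) := by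
          have := h₃ i
          have := h₄ j
          gcongr
      _ = _ := by rw [hN, hC]; ring_nf
  · refine summable_of_summable_sum_antidiagonal (fun p => by positivity) ?_
    have e : ∀ n, ∑ p ∈ antidiagonal n, C * (r ^ 3 * s) ^ (p.1 + p.2) *
        ((p.1 + p.2).choose p.1 * (√X ^ p.1 * √Y ^ p.2)) = C * (r ^ 3 * s ^ 2) ^ n := by
      intro n
      have : ∀ p ∈ antidiagonal n, C * (r ^ 3 * s) ^ (p.1 + p.2) *
          ((p.1 + p.2).choose p.1 * (√X ^ p.1 * √Y ^ p.2))
          = C * (r ^ 3 * s) ^ n * (n.choose p.1 * (√X ^ p.1 * √Y ^ p.2)) := by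
        intro p hp
        rw [mem_antidiagonal.1 hp]
      rw [Finset.sum_congr rfl this, ← Finset.mul_sum, sum_antidiagonal_choose_mul_pow, ← hs]
      ring_nf
    simp_rw [e]
    exact (summable_geometric_of_lt_one (by positivity) hr).mul_left _

lemma summable_appellF4Term {α β γ δ X Y : ℝ} (hγ : ∀ m : ℕ, γ + m ≠ 0) (hδ : ∀ m : ℕ, δ + m ≠ 0)
    (h : √|X| + √|Y| < 1) : Summable (appellF4Term α β γ δ X Y) := by
  refine Summable.of_norm ?_
  refine (summable_appellCoeff (α := α) (β := β) hγ hδ (abs_nonneg X) (abs_nonneg Y) h).congr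
    fun p => ?_
  rw [appellF4Term_eq, norm_mul, norm_mul, norm_pow, norm_pow]
  simp only [Real.norm_eq_abs]

lemma hasSum_choose_mul_pow (n : ℕ) (u : ℝ) :
    HasSum (fun p : ℕ => (n.choose p : ℝ) * u ^ p) ((1 + u) ^ n) := by
  rw [add_comm, add_pow]
  simp only [one_pow, mul_one]
  simp_rw [mul_comm (u ^ _)]
  refine hasSum_sum_of_ne_finset_zero fun p hp => ?_
  rw [Nat.choose_eq_zero_of_lt (by simpa using hp), Nat.cast_zero, zero_mul]

/-- The expansion of `F₄(α, β; γ, δ; x₁ (1 - x₂), x₂ (1 - x₁))` in powers of `x₁` and `x₂`. -/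
lemma hasSum_appellF4_expansion {α β γ δ x₁ x₂ : ℝ} (hγ : ∀ m : ℕ, γ + m ≠ 0)
    (hδ : ∀ m : ℕ, δ + m ≠ 0) (h : √(|x₁| * (1 + |x₂|)) + √(|x₂| * (1 + |x₁|)) < 1) :
    HasSum (fun x : ℕ × ℕ => (∑ u ∈ antidiagonal x.1, ∑ v ∈ antidiagonal x.2,
      appellCoeff α β γ δ u.2 v.2 * ((v.2.choose u.1) * (-1) ^ u.1 *
        ((u.2.choose v.1) * (-1) ^ v.1))) * (x₁ ^ x.1 * x₂ ^ x.2))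
      (∑' p, appellF4Term α β γ δ (x₁ * (1 - x₂)) (x₂ * (1 - x₁)) p) := by
  -- The first pair indexes the F₄ series; the second indexes the binomial expansions of (1-x₁)^j
  -- and (1-x₂)^i.
  let F : (ℕ × ℕ) × (ℕ × ℕ) → ℝ := fun y =>
    appellCoeff α β γ δ y.1.1 y.1.2 * (x₁ ^ y.1.1 * x₂ ^ y.1.2) *
      ((y.1.2.choose y.2.1 * (-x₁) ^ y.2.1) * (y.1.1.choose y.2.2 * (-x₂) ^ y.2.2))
  have hfib : ∀ (a b : ℝ) (i j : ℕ), HasSum (fun v : ℕ × ℕ =>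
      (j.choose v.1 * a ^ v.1) * (i.choose v.2 * b ^ v.2)) ((1 + a) ^ j * (1 + b) ^ i) := by
    intro a b i j
    have s1 := hasSum_choose_mul_pow j a
    have s2 := hasSum_choose_mul_pow i b
    have s3 := summable_mul_of_summable_norm s1.summable.norm s2.summable.norm
    exact HasSum.mul s1 s2 s3
  have hFs : Summable F := by
    refine Summable.of_norm ?_
    have e : ∀ y : (ℕ × ℕ) × (ℕ × ℕ), ‖F y‖ = |appellCoeff α β γ δ y.1.1 y.1.2| *
        (|x₁| ^ y.1.1 * |x₂| ^ y.1.2) *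
      ((y.1.2.choose y.2.1 * |x₁| ^ y.2.1) * (y.1.1.choose y.2.2 * |x₂| ^ y.2.2)) := by
      intro y
      simp only [F, Real.norm_eq_abs, abs_mul, abs_pow, abs_neg, Nat.abs_cast]
    simp_rw [e]
    refine (summable_prod_of_nonneg fun y => by positivity).2 ⟨fun u => ?_, ?_⟩
    · have h1 := (hfib |x₁| |x₂| u.1 u.2).summable.mul_left
        (|appellCoeff α β γ δ u.1 u.2| * (|x₁| ^ u.1 * |x₂| ^ u.2))
      exact h1
    · have hs := summable_appellCoeff (α := α) (β := β) hγ hδ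
        (X := |x₁| * (1 + |x₂|)) (Y := |x₂| * (1 + |x₁|)) (by positivity) (by positivity) h
      refine hs.congr fun u => ?_
      have h1 := (hfib |x₁| |x₂| u.1 u.2).mul_left
        (|appellCoeff α β γ δ u.1 u.2| * (|x₁| ^ u.1 * |x₂| ^ u.2))
      refine Eq.trans ?_ h1.tsum_eq.symm
      rw [mul_pow, mul_pow]
      ring
  have hF1 : HasSum (appellF4Term α β γ δ (x₁ * (1 - x₂)) (x₂ * (1 - x₁))) (∑' y, F y) := by
    refine hFs.hasSum.prod_fiberwise fun u => ?_
    have := (hfib (-x₁) (-x₂) u.1 u.2).mul_left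
      (appellCoeff α β γ δ u.1 u.2 * (x₁ ^ u.1 * x₂ ^ u.2))
    have e : appellF4Term α β γ δ (x₁ * (1 - x₂)) (x₂ * (1 - x₁)) u
        = appellCoeff α β γ δ u.1 u.2 * (x₁ ^ u.1 * x₂ ^ u.2) *
          ((1 + -x₁) ^ u.2 * (1 + -x₂) ^ u.1) := by
      rw [appellF4Term_eq, mul_pow, mul_pow]
      ring
    rw [e]
    exact this
  rw [hF1.tsum_eq]
  -- The indices are permuted so that the first pair carries the exponents of x₁ and the second
  -- those of x₂.
  let e : (ℕ × ℕ) × (ℕ × ℕ) ≃ (ℕ × ℕ) × (ℕ × ℕ) :=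
    (Equiv.prodProdProdComm ℕ ℕ ℕ ℕ).trans (Equiv.prodComm _ _)
  have hF2 : HasSum (fun y : (ℕ × ℕ) × (ℕ × ℕ) => F ((y.1.2, y.2.2), (y.1.1, y.2.1)))
      (∑' y, F y) := (e.hasSum_iff (f := F)).2 hFs.hasSum
  refine Eq.mp (congrArg (fun g => HasSum g _) (funext fun x => ?_))
    (HasSum.sum_antidiagonal_prod hF2)
  symm
  rw [Finset.sum_mul]
  refine Finset.sum_congr rfl fun u hu => ?_
  rw [Finset.sum_mul]
  refine Finset.sum_congr rfl fun v hv => ?_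
  simp only [F]
  rw [← mem_antidiagonal.1 hu, ← mem_antidiagonal.1 hv, neg_pow x₁, neg_pow x₂, pow_add, pow_add]
  ring

/-! ### Expansion of the average over the knots near the origin -/

lemma knots_mulVec_bary_one (x₁ x₂ : ℝ) (t : Fin 2 → ℝ) :
    (knots x₁ x₂ *ᵥ bary t) 1 = 1 - x₂ * (bary t 0 + bary t 1) := by
  have hs : bary t 0 + bary t 1 + bary t 2 = 1 := (Fin.sum_univ_three _).symm.trans (sum_bary t)
  have h : (knots x₁ x₂ *ᵥ bary t) 1
      = (1 - x₂) * bary t 0 + (1 - x₂) * bary t 1 + 1 * bary t 2 := by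
    rw [Matrix.mulVec, dotProduct]
    exact Fin.sum_univ_three _
  rw [h]
  linear_combination hs

lemma knots_mulVec_bary_zero (x₁ x₂ : ℝ) (t : Fin 2 → ℝ) :
    (knots x₁ x₂ *ᵥ bary t) 0
      = 1 - x₂ * (bary t 0 + bary t 1) - x₁ * (1 - x₂ * bary t 0) := by
  have hs : bary t 0 + bary t 1 + bary t 2 = 1 := (Fin.sum_univ_three _).symm.trans (sum_bary t)
  have h : (knots x₁ x₂ *ᵥ bary t) 0
      = (1 - x₁) * (1 - x₂) * bary t 0 + (1 - x₁ - x₂) * bary t 1 + (1 - x₁) * bary t 2 := by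
    rw [Matrix.mulVec, dotProduct]
    exact Fin.sum_univ_three _
  rw [h]
  linear_combination (1 - x₁) * hs

/-- The Dirichlet average of `R_{-a}(b; ·)` over the triangle spanned by the knots. -/
def knotAverage (α : ℝ) (b : Fin 2 → ℝ) (d : Fin 3 → ℝ) (x₁ x₂ : ℝ) : ℝ :=
  ∫ t in simplexE 2, hyperR α b (knots x₁ x₂ *ᵥ bary t) * dirichletDensity d t

lemma bary_zero_add_one_mem {t : Fin 2 → ℝ} (ht : t ∈ simplexE 2) :
    0 ≤ bary t 0 + bary t 1 ∧ bary t 0 + bary t 1 ≤ 1 := by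
  have hs : bary t 0 + bary t 1 + bary t 2 = 1 := (Fin.sum_univ_three _).symm.trans (sum_bary t)
  have h0 := bary_nonneg ht 0
  have h1 := bary_nonneg ht 1
  have h2 := bary_nonneg ht 2
  constructor <;> linarith

/-- The terms of the expansion of `R_{-α}(β, γ - β; X t)` in powers of `x₁` and `x₂`. -/
def knotTerm (α β γ x₁ x₂ : ℝ) (p : ℕ × (ℕ × ℕ)) : ℝ :=
  rising α p.1 * rising β p.1 / (rising γ p.1 * p.1.factorial) * x₁ ^ p.1 *
    ((p.1.choose p.2.1 * (-x₂) ^ p.2.1) * (rising (α + p.1) p.2.2 / p.2.2.factorial * x₂ ^ p.2.2))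

lemma hasSum_knot_fiber {a u v : ℝ} (hv : |v| < 1) (k : ℕ) :
    HasSum (fun p : ℕ × ℕ => (k.choose p.1 * u ^ p.1) * (rising a p.2 / p.2.factorial * v ^ p.2))
      ((1 + u) ^ k * (1 - v) ^ (-a)) := by
  have s1 := hasSum_choose_mul_pow k u
  have s2 := hasSum_rising_mul_pow a hv
  have s3 := summable_mul_of_summable_norm s1.summable.norm s2.summable.norm
  exact HasSum.mul s1 s2 s3

/-- For fixed k the majorants over the remaining two indices add up to (1+|x₂|)^k (1-|x₂|)^(-|α|-k),
so the sum over k is dominated by a geometric series. -/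
lemma summable_knotTerm {α β γ x₁ x₂ : ℝ} (hγ : ∀ m : ℕ, γ + m ≠ 0) (h1 : |x₁| ≤ 1 / 10)
    (h2 : |x₂| ≤ 1 / 10) : Summable fun p => |knotTerm α β γ x₁ x₂ p| := by
  have hx2 : |(|x₂|)| < 1 := by rw [abs_abs]; linarith
  refine Summable.of_nonneg_of_le (fun p => abs_nonneg _)
    (f := fun p : ℕ × (ℕ × ℕ) => |rising α p.1 * rising β p.1 / (rising γ p.1 * p.1.factorial)| *
      |x₁| ^ p.1 * ((p.1.choose p.2.1 * |x₂| ^ p.2.1) *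
        (rising (|α| + p.1) p.2.2 / p.2.2.factorial * |x₂| ^ p.2.2))) (fun p => ?_) ?_
  · simp only [knotTerm, abs_mul, abs_pow, abs_neg, Nat.abs_cast, abs_div (rising (α + p.1) p.2.2)]
    have := norm_rising_le (α + p.1) (A := |α| + p.1)
      ((norm_add_le _ _).trans (by simp)) p.2.2
    rw [Real.norm_eq_abs] at this
    gcongr
  · have hnn : ∀ (k q : ℕ), 0 ≤ rising (|α| + k) q := fun k q => rising_nonneg (by positivity) q
    refine (summable_prod_of_nonneg fun p => ?_).2 ⟨fun k => ?_, ?_⟩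
    · have := hnn p.1 p.2.2
      simp only [Pi.zero_apply]
      positivity
    · have h := (hasSum_knot_fiber (a := |α| + k) (u := |x₂|) hx2 k).summable.mul_left
        (|rising α k * rising β k / (rising γ k * k.factorial)| * |x₁| ^ k)
      exact h
    · obtain ⟨r, hr1, hr⟩ := exists_one_lt_pow_mul_lt_one (ρ := 1 / 2) (by norm_num) 3
      obtain ⟨C₁, hC₁, h₁⟩ := exists_rising_le (abs_nonneg α) hr1
      obtain ⟨C₂, hC₂, h₂⟩ := exists_rising_le (abs_nonneg β) hr1
      obtain ⟨C₃, hC₃, h₃⟩ := exists_factorial_div_rising_le hγ hr1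
      have hpos : 0 < 1 - |x₂| := by linarith
      set D := (1 - |x₂|) ^ (-|α|) with hD
      have hD0 : 0 ≤ D := Real.rpow_nonneg hpos.le _
      refine Summable.of_nonneg_of_le (fun k => tsum_nonneg fun p => ?_)
        (f := fun k => C₁ * C₂ * C₃ * D * (r ^ 3 * (1 / 2)) ^ k) (fun k => ?_)
        ((summable_geometric_of_lt_one (by positivity) hr).mul_left _)
      · have := hnn k p.2
        simp only
        positivity
      · have h := (hasSum_knot_fiber (a := |α| + k) (u := |x₂|) hx2 k).mul_left
          (|rising α k * rising β k / (rising γ k * k.factorial)| * |x₁| ^ k)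
        refine h.tsum_eq.le.trans ?_
        have e1 : |rising α k * rising β k / (rising γ k * k.factorial)|
            = (|rising α k| / k.factorial) * (|rising β k| / k.factorial) *
              (k.factorial / ‖rising γ k‖) := by
          simp only [abs_div, abs_mul, Nat.abs_cast, Real.norm_eq_abs]
          have := factorial_cast_ne_zero (K := ℝ) k
          field_simp
        have e4 : |rising α k| / k.factorial ≤ C₁ * r ^ k :=
          (div_le_div_of_nonneg_right (norm_rising_le α le_rfl k) (by positivity)).trans (h₁ k)
        have e5 : |rising β k| / k.factorial ≤ C₂ * r ^ k :=
          (div_le_div_of_nonneg_right (norm_rising_le β le_rfl k) (by positivity)).trans (h₂ k)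
        have e6 : (1 - |x₂|) ^ (-(|α| + k)) = D * (1 / (1 - |x₂|)) ^ k := by
          rw [neg_add, Real.rpow_add hpos, Real.rpow_neg hpos.le (k : ℝ), Real.rpow_natCast,
            one_div, inv_pow]
        -- The bound 1/10 is generous: the ratio is at most 0.11/0.9. Any neighbourhood of the
        -- origin would serve for the later continuation.
        have e7 : |x₁| * (1 + |x₂|) * (1 / (1 - |x₂|)) ≤ 1 / 2 := by
          rw [mul_one_div, div_le_iff₀ hpos]
          nlinarith [abs_nonneg x₁, abs_nonneg x₂]
        rw [e1, e6]
        calc _ = (|rising α k| / k.factorial) * (|rising β k| / k.factorial) *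
              (k.factorial / ‖rising γ k‖) * (D * (|x₁| * (1 + |x₂|) * (1 / (1 - |x₂|))) ^ k) := by
              rw [mul_pow, mul_pow]; ring
          _ ≤ (C₁ * r ^ k) * (C₂ * r ^ k) * (C₃ * r ^ k) * (D * (1 / 2) ^ k) := by
              have := h₃ k
              gcongr
          _ = _ := by rw [mul_pow]; ring

/-- The prefactor y₁^(-α) of the Gauss series joins the denominators, giving (1 - x₂s)^k (1 -
x₂w)^(-α-k) in the k-th term; these two powers are then expanded in x₂. -/
lemma hasSum_hyperR_knots {α β γ x₁ x₂ : ℝ} (hβ : 0 < β) (hγ : ∀ m : ℕ, γ + m ≠ 0)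
    (h1 : |x₁| ≤ 1 / 10) (h2 : |x₂| ≤ 1 / 10) {t : Fin 2 → ℝ} (ht : t ∈ simplexE 2) :
    HasSum (fun p : ℕ × (ℕ × ℕ) => knotTerm α β γ x₁ x₂ p *
        (bary t 0 ^ p.2.1 * (bary t 0 + bary t 1) ^ p.2.2))
      (hyperR α ![β, γ - β] (knots x₁ x₂ *ᵥ bary t)) := by
  have ht0 := bary_nonneg ht 0
  have ht0' := bary_le_one ht 0
  obtain ⟨hw0, hw1⟩ := bary_zero_add_one_mem ht
  have hz1 := knots_mulVec_bary_one x₁ x₂ t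
  have hz0 := knots_mulVec_bary_zero x₁ x₂ t
  set w := bary t 0 + bary t 1 with hw
  set s := bary t 0 with hs
  have b1 : |x₂ * w| ≤ 1 / 10 := by
    rw [abs_mul, abs_of_nonneg hw0]; nlinarith [abs_nonneg x₂]
  have b2 : |x₂ * s| ≤ 1 / 10 := by
    rw [abs_mul, abs_of_nonneg ht0]; nlinarith [abs_nonneg x₂]
  have hpos : 0 < 1 - x₂ * w := by linarith [(abs_le.1 b1).2]
  have b3 : |x₁ * (1 - x₂ * s)| ≤ 11 / 100 := by
    rw [abs_mul]
    have : |1 - x₂ * s| ≤ 11 / 10 := by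
      rw [abs_le]; constructor <;> linarith [(abs_le.1 b2).1, (abs_le.1 b2).2]
    exact (mul_le_mul h1 this (abs_nonneg _) (by norm_num)).trans (by norm_num)
  have e0 : 1 - (knots x₁ x₂ *ᵥ bary t) 0 / (knots x₁ x₂ *ᵥ bary t) 1
      = x₁ * (1 - x₂ * s) / (1 - x₂ * w) := by
    rw [hz0, hz1]; field_simp; ring
  have hlt : |1 - (knots x₁ x₂ *ᵥ bary t) 0 / (knots x₁ x₂ *ᵥ bary t) 1| < 1 := by
    rw [e0, abs_div, abs_of_pos hpos, div_lt_one hpos]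
    linarith [(abs_le.1 b1).2]
  have hR := hyperR_eq_tsum_of_abs_lt (a := α) (z := knots x₁ x₂ *ᵥ bary t) (β := β)
    (w := γ - β) (by rw [hz1]; exact hpos) hlt hβ
    (by intro m h; rw [add_sub_cancel] at h; exact hγ m (by rw [h]; ring))
  rw [add_sub_cancel, e0, hz1] at hR
  have hsum : Summable fun p : ℕ × (ℕ × ℕ) => knotTerm α β γ x₁ x₂ p * (s ^ p.2.1 * w ^ p.2.2) := by
    refine Summable.of_norm_bounded (summable_knotTerm (α := α) (β := β) hγ h1 h2) fun p => ?_
    rw [norm_mul, Real.norm_eq_abs]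
    refine mul_le_of_le_one_right (abs_nonneg _) ?_
    rw [Real.norm_of_nonneg (by positivity)]
    exact mul_le_one₀ (pow_le_one₀ ht0 ht0') (by positivity) (pow_le_one₀ hw0 hw1)
  have hfib : ∀ k : ℕ, HasSum (fun v : ℕ × ℕ => knotTerm α β γ x₁ x₂ (k, v) *
      (s ^ v.1 * w ^ v.2)) ((1 - x₂ * w) ^ (-α) * (rising α k * rising β k /
        (rising γ k * k.factorial) * (x₁ * (1 - x₂ * s) / (1 - x₂ * w)) ^ k)) := by
    intro k
    have h := (hasSum_knot_fiber (a := α + k) (u := -(x₂ * s)) (v := x₂ * w)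
      (by linarith) k).mul_left (rising α k * rising β k / (rising γ k * k.factorial) * x₁ ^ k)
    have e1 : (fun v : ℕ × ℕ => knotTerm α β γ x₁ x₂ (k, v) * (s ^ v.1 * w ^ v.2))
        = fun v => rising α k * rising β k / (rising γ k * k.factorial) * x₁ ^ k *
          ((k.choose v.1 * (-(x₂ * s)) ^ v.1) * (rising (α + k) v.2 / v.2.factorial *
            (x₂ * w) ^ v.2)) := by
      funext v
      simp only [knotTerm]
      rw [← neg_mul, mul_pow, mul_pow]
      ring
    rw [e1]
    refine Eq.mp (congrArg (HasSum _) ?_) h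
    rw [neg_add, Real.rpow_add hpos, Real.rpow_neg hpos.le (k : ℝ), Real.rpow_natCast, div_pow,
      mul_pow]
    field_simp
    ring
  have := hsum.hasSum.prod_fiberwise hfib
  rw [hR, ← tsum_mul_left, this.tsum_eq]
  exact hsum.hasSum

/-- Termwise integration is justified by the uniform majorant, because s and w lie in [0, 1]. The
three conditions on d turn the moments into exactly the quotients on the right of `appell_coeff`. -/
lemma knotAverage_eq_tsum {α β γ δ x₁ x₂ : ℝ} {d : Fin 3 → ℝ} (hd : ∀ i, 0 < d i)
    (hd0 : d 0 = γ + δ - α - 1) (hd01 : d 0 + d 1 = β) (hd012 : d 0 + d 1 + d 2 = δ)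
    (hγ : ∀ m : ℕ, γ + m ≠ 0) (h1 : |x₁| ≤ 1 / 10) (h2 : |x₂| ≤ 1 / 10) :
    knotAverage α ![β, γ - β] d x₁ x₂
      = ∑' p, appellF4Term α β γ δ (x₁ * (1 - x₂)) (x₂ * (1 - x₁)) p := by
  have hβ : 0 < β := by have := hd 0; have := hd 1; linarith
  have hδ : 0 < δ := by have := hd 2; linarith
  have hβ' : ∀ m : ℕ, β + m ≠ 0 := fun m => by positivity
  have hδ' : ∀ m : ℕ, δ + m ≠ 0 := fun m => by positivity
  let F : ℕ × (ℕ × ℕ) → (Fin 2 → ℝ) → ℝ := fun p t => knotTerm α β γ x₁ x₂ p *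
    (bary t 0 ^ p.2.1 * (bary t 0 + bary t 1) ^ p.2.2 * dirichletDensity d t)
  have hFi : ∀ p, IntegrableOn (F p) (simplexE 2) := fun p =>
    (dirichlet_moment_three hd p.2.1 p.2.2).1.const_mul _
  have hD := (dirichlet_moment_three hd 0 0).1
  simp only [pow_zero, mul_one, one_mul] at hD
  have hnorm : ∀ p, ∫ t in simplexE 2, ‖F p t‖
      ≤ |knotTerm α β γ x₁ x₂ p| * ∫ t in simplexE 2, dirichletDensity d t := by
    intro p
    rw [← integral_const_mul]
    refine setIntegral_mono_on (hFi p).norm (hD.const_mul _) (measurableSet_simplexE 2) ?_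
    intro t ht
    obtain ⟨hw0, hw1⟩ := bary_zero_add_one_mem ht
    have ht0 := bary_nonneg ht 0
    have hden := dirichletDensity_nonneg hd ht
    simp only [F]
    rw [norm_mul, Real.norm_eq_abs]
    refine mul_le_mul_of_nonneg_left ?_ (abs_nonneg _)
    rw [Real.norm_of_nonneg (by positivity)]
    exact mul_le_of_le_one_left hden (mul_le_one₀ (pow_le_one₀ ht0 (bary_le_one ht 0))
      (by positivity) (pow_le_one₀ hw0 hw1))
  have hsum : Summable fun p => ∫ t in simplexE 2, ‖F p t‖ :=
    Summable.of_nonneg_of_le (fun p => integral_nonneg fun t => norm_nonneg _) hnorm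
      ((summable_knotTerm hγ h1 h2).mul_right _)
  have key := hasSum_integral_of_summable_integral_norm hFi hsum
  have e1 : ∫ t in simplexE 2, ∑' p, F p t = knotAverage α ![β, γ - β] d x₁ x₂ := by
    refine setIntegral_congr_fun (measurableSet_simplexE 2) fun t ht => ?_
    have h := (hasSum_hyperR_knots (α := α) hβ hγ h1 h2 ht).mul_right (dirichletDensity d t)
    rw [← h.tsum_eq]
    exact tsum_congr fun p => by simp only [F]; ring
  rw [e1] at key
  have key2 := HasSum.sum_antidiagonal_right key
  have hsq : √(|x₁| * (1 + |x₂|)) + √(|x₂| * (1 + |x₁|)) < 1 := by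
    have s1 : √(|x₁| * (1 + |x₂|)) < 1 / 2 := by
      rw [Real.sqrt_lt' (by norm_num)]
      nlinarith [abs_nonneg x₁, abs_nonneg x₂]
    have s2 : √(|x₂| * (1 + |x₁|)) < 1 / 2 := by
      rw [Real.sqrt_lt' (by norm_num)]
      nlinarith [abs_nonneg x₁, abs_nonneg x₂]
    linarith
  have key3 := hasSum_appellF4_expansion (α := α) (β := β) hγ hδ' hsq
  refine key2.unique ?_
  refine Eq.mp (congrArg (fun g => HasSum g _) (funext fun x => ?_)) key3
  have hc := appell_coeff α β γ δ hβ' hγ hδ' x.1 x.2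
  simp only [appellCoeff]
  rw [hc, Finset.mul_sum, Finset.sum_mul]
  refine Finset.sum_congr rfl fun v hv => ?_
  simp only [F, integral_const_mul]
  rw [(dirichlet_moment_three hd v.1 v.2).2, mem_antidiagonal.1 hv, hd012, hd01, hd0, knotTerm,
    ← mem_antidiagonal.1 hv, pow_add]
  simp only
  rw [neg_pow x₂ v.1]
  ring

/-! ### Real-analyticity of the average on Λ -/

lemma knots_pos {x : ℝ × ℝ} (hx : x ∈ regionΛ) (i : Fin 2) (j : Fin 3) : 0 < knots x.1 x.2 i j := by
  obtain ⟨h1, h2, h3⟩ := hx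
  have h4 : 0 < (1 - x.1) * (1 - x.2) := mul_pos (by linarith) (by linarith)
  fin_cases i <;> fin_cases j <;> simp [knots] <;> first | exact h4 | linarith

/-- Take l to be the largest entry M of the knot matrix and let m > 0 be the smallest. Convex
combinations divided by M lie in [m/M, 1], so a single expansion of R converges uniformly on the
whole triangle. -/
lemma exists_knots_bound {x : ℝ × ℝ} (hx : x ∈ regionΛ) :
    ∃ l ρ : ℝ, 0 < l ∧ 0 ≤ ρ ∧ ρ < 1 ∧ ∀ t ∈ simplexE 2, ∀ i,
      |1 - (knots x.1 x.2 *ᵥ bary t) i / l| ≤ ρ := by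
  obtain ⟨p, hp⟩ := Finite.exists_min fun p : Fin 2 × Fin 3 => knots x.1 x.2 p.1 p.2
  obtain ⟨q, hq⟩ := Finite.exists_max fun p : Fin 2 × Fin 3 => knots x.1 x.2 p.1 p.2
  set m := knots x.1 x.2 p.1 p.2
  set M := knots x.1 x.2 q.1 q.2
  have hm : 0 < m := knots_pos hx _ _
  have hmM : m ≤ M := hp q
  have hM : 0 < M := hm.trans_le hmM
  have hmM' : m / M ≤ 1 := (div_le_one hM).2 hmM
  refine ⟨M, 1 - m / M, hM, by linarith, by linarith [div_pos hm hM], fun t ht i => ?_⟩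
  have hs := sum_bary t
  have h1 : (knots x.1 x.2 *ᵥ bary t) i ≤ M := by
    calc _ = ∑ j, knots x.1 x.2 i j * bary t j := rfl
      _ ≤ ∑ j, M * bary t j := Finset.sum_le_sum fun j _ =>
        mul_le_mul_of_nonneg_right (hq (i, j)) (bary_nonneg ht j)
      _ = M := by rw [← Finset.mul_sum, hs, mul_one]
  have h2 : m ≤ (knots x.1 x.2 *ᵥ bary t) i := by
    calc m = ∑ j, m * bary t j := by rw [← Finset.mul_sum, hs, mul_one]
      _ ≤ ∑ j, knots x.1 x.2 i j * bary t j := Finset.sum_le_sum fun j _ =>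
        mul_le_mul_of_nonneg_right (hp (i, j)) (bary_nonneg ht j)
  have h3 := (div_le_one hM).2 h1
  have h4 := div_le_div_of_nonneg_right h2 hM.le
  rw [abs_of_nonneg (by linarith)]
  linarith

lemma isCompact_simplexE (n : ℕ) : IsCompact (simplexE n) := by
  refine (isCompact_Icc (a := (0 : Fin n → ℝ)) (b := 1)).of_isClosed_subset ?_ ?_
  · have h1 : IsClosed {t : Fin n → ℝ | ∀ j, 0 ≤ t j} := by
      simp only [Set.ofPred_forall]
      exact isClosed_iInter fun j => isClosed_le continuous_const (continuous_apply j)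
    exact h1.inter (isClosed_le (continuous_finsetSum _ fun j _ => continuous_apply j)
      continuous_const)
  · intro t ht
    refine ⟨fun j => ht.1 j, fun j => ?_⟩
    exact (Finset.single_le_sum (fun i _ => ht.1 i) (Finset.mem_univ j)).trans ht.2

lemma continuousOn_hyperR_knots {α β w : ℝ} (hβ : 0 < β) (hc : ∀ m : ℕ, β + w + m ≠ 0)
    {x : ℝ × ℝ} (hx : x ∈ regionΛ) :
    ContinuousOn (fun t => hyperR α ![β, w] (knots x.1 x.2 *ᵥ bary t)) (simplexE 2) := by
  obtain ⟨l, ρ, hl, hρ0, hρ, hb⟩ := exists_knots_bound hx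
  have hcy : ∀ i, Continuous fun t : Fin 2 → ℝ => 1 - (knots x.1 x.2 *ᵥ bary t) i / l := by
    intro i
    have : Continuous fun t : Fin 2 → ℝ => (knots x.1 x.2 *ᵥ bary t) i := by
      change Continuous fun t : Fin 2 → ℝ => ∑ j, knots x.1 x.2 i j * bary t j
      exact continuous_finsetSum _ fun j _ => continuous_const.mul
        ((continuous_apply j).comp continuous_bary)
    exact continuous_const.sub (this.div_const l)
  obtain ⟨u, hu, hbound⟩ := exists_summable_norm_rTerm_le (α : ℂ) (b₀ := β) (b₁ := w)
    (fun m => by exact_mod_cast hc m) hρ0 hρ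
  have hs : ContinuousOn (fun t => ∑' n, rTerm α β w (1 - (knots x.1 x.2 *ᵥ bary t) 0 / l)
      (1 - (knots x.1 x.2 *ᵥ bary t) 1 / l) n) (simplexE 2) := by
    refine continuousOn_tsum (fun n => ?_) hu fun n t ht => ?_
    · refine Continuous.continuousOn ?_
      simp only [rTerm]
      exact continuous_const.mul (continuous_finsetSum _ fun p _ =>
        continuous_const.mul (((hcy 0).pow _).mul ((hcy 1).pow _)))
    · rw [← Complex.norm_real, ofReal_rTerm]
      exact hbound.self_of_nhds n _ _ (by rw [Complex.norm_real]; exact hb t ht 0)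
        (by rw [Complex.norm_real]; exact hb t ht 1)
  refine ((continuousOn_const (c := l ^ (-α))).mul hs).congr fun t ht => ?_
  exact hyperR_eq_tsum hl ((hb t ht 0).trans_lt hρ) ((hb t ht 1).trans_lt hρ) hβ
    fun m h => hc m (by rw [h]; ring)

lemma integrableOn_dirichletDensity {d : Fin 3 → ℝ} (hd : ∀ i, 0 < d i) :
    IntegrableOn (dirichletDensity d) (simplexE 2) := by
  have hD := (dirichlet_moment_three hd 0 0).1
  simpa only [pow_zero, mul_one, one_mul] using hD

lemma integrableOn_hyperR_knots {α β w : ℝ} (hβ : 0 < β) (hc : ∀ m : ℕ, β + w + m ≠ 0)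
    {x : ℝ × ℝ} (hx : x ∈ regionΛ) {d : Fin 3 → ℝ} (hd : ∀ i, 0 < d i) :
    IntegrableOn (fun t => hyperR α ![β, w] (knots x.1 x.2 *ᵥ bary t) * dirichletDensity d t)
      (simplexE 2) :=
  (integrableOn_dirichletDensity hd).continuousOn_mul (continuousOn_hyperR_knots hβ hc hx)
    (isCompact_simplexE 2)

open BoundedContinuousFunction in
/-- A bounded real function of the barycentric coordinates, as an element of the Banach algebra
of bounded continuous functions on the simplex. -/
def simplexFunction (f : (Fin 2 → ℝ) → ℝ) (hf : Continuous f)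
    (hb : ∀ t ∈ simplexE 2, |f t| ≤ 1) : simplexE 2 →ᵇ ℂ :=
  ofNormedAddCommGroup (fun t => (f t : ℂ)) (by fun_prop) 1 fun t => by
    rw [Complex.norm_real]; exact hb t t.2

-- The series of R is lifted to the Banach algebra of bounded continuous functions on the simplex.
-- There ξ and η are polynomials in complex (x₁, x₂), and the norm bounds are uniform in t.
-- Integration against the density is a continuous functional, so the integrated series is a locally
-- uniformly convergent series of holomorphic functions near the real point.
open BoundedContinuousFunction in
theorem analyticAt_knotAverage {α β w : ℝ} (hβ : 0 < β) (hc : ∀ m : ℕ, β + w + m ≠ 0)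
    {x : ℝ × ℝ} (hx : x ∈ regionΛ) {d : Fin 3 → ℝ} (hd : ∀ i, 0 < d i) :
    AnalyticAt ℝ (fun x : ℝ × ℝ => knotAverage α ![β, w] d x.1 x.2) x := by
  obtain ⟨l, ρ₀, hl, hρ0, hρ1, hb⟩ := exists_knots_bound hx
  -- The gap between ρ₀ and ρ leaves room for a complex neighbourhood on which the expansion still
  -- converges.
  obtain ⟨ρ, hρ₀ρ, hρ⟩ := exists_between hρ1
  have hρ0' : 0 ≤ ρ := hρ0.trans hρ₀ρ.le
  obtain ⟨u, hu, hbound⟩ := exists_summable_norm_rTerm_le (α : ℂ) (b₀ := β) (b₁ := w)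
    (fun m => by exact_mod_cast hc m) hρ0' hρ
  replace hbound := hbound.self_of_nhds
  simp only at hbound
  let S : simplexE 2 →ᵇ ℂ := simplexFunction (fun t => bary t 0) (by fun_prop) fun t ht => by
    rw [abs_of_nonneg (bary_nonneg ht 0)]; exact bary_le_one ht 0
  let W : simplexE 2 →ᵇ ℂ := simplexFunction (fun t => bary t 0 + bary t 1) (by fun_prop)
    fun t ht => by
      obtain ⟨h1, h2⟩ := bary_zero_add_one_mem ht
      rw [abs_of_nonneg h1]; exact h2
  let Y₁ : ℂ × ℂ → (simplexE 2 →ᵇ ℂ) := fun z => 1 - z.2 • W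
  let Y₀ : ℂ × ℂ → (simplexE 2 →ᵇ ℂ) := fun z => 1 - z.2 • W - z.1 • (1 - z.2 • S)
  let ξ : ℂ × ℂ → (simplexE 2 →ᵇ ℂ) := fun z => 1 - (l : ℂ)⁻¹ • Y₀ z
  let η : ℂ × ℂ → (simplexE 2 →ᵇ ℂ) := fun z => 1 - (l : ℂ)⁻¹ • Y₁ z
  have hY₁a : ∀ z, AnalyticAt ℂ Y₁ z := fun z =>
    analyticAt_const.sub (analyticAt_snd.smul analyticAt_const)
  have hY₀a : ∀ z, AnalyticAt ℂ Y₀ z := fun z => (hY₁a z).sub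
    (analyticAt_fst.smul (analyticAt_const.sub (analyticAt_snd.smul analyticAt_const)))
  have hξa : ∀ z, AnalyticAt ℂ ξ z := fun z => analyticAt_const.sub
    ((analyticAt_const (v := (l : ℂ)⁻¹)).smul (hY₀a z))
  have hηa : ∀ z, AnalyticAt ℂ η z := fun z => analyticAt_const.sub
    ((analyticAt_const (v := (l : ℂ)⁻¹)).smul (hY₁a z))
  let ι : ℝ × ℝ → ℂ × ℂ := fun x => ((x.1 : ℂ), (x.2 : ℂ))
  have hξr : ∀ (x : ℝ × ℝ) (t : simplexE 2), ξ (ι x) t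
      = ((1 - (knots x.1 x.2 *ᵥ bary (t : Fin 2 → ℝ)) 0 / l : ℝ) : ℂ) := by
    intro x t
    rw [knots_mulVec_bary_zero]
    change 1 - (l : ℂ)⁻¹ * (1 - (x.2 : ℂ) * ((bary (t : Fin 2 → ℝ) 0 + bary (t : Fin 2 → ℝ) 1 : ℝ) : ℂ)
      - (x.1 : ℂ) * (1 - (x.2 : ℂ) * ((bary (t : Fin 2 → ℝ) 0 : ℝ) : ℂ))) = _
    push_cast
    rw [div_eq_inv_mul]
  have hηr : ∀ (x : ℝ × ℝ) (t : simplexE 2), η (ι x) t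
      = ((1 - (knots x.1 x.2 *ᵥ bary (t : Fin 2 → ℝ)) 1 / l : ℝ) : ℂ) := by
    intro x t
    rw [knots_mulVec_bary_one]
    change 1 - (l : ℂ)⁻¹ * (1 - (x.2 : ℂ) *
      ((bary (t : Fin 2 → ℝ) 0 + bary (t : Fin 2 → ℝ) 1 : ℝ) : ℂ)) = _
    push_cast
    rw [div_eq_inv_mul]
  let U : Set (ℂ × ℂ) := {z | ‖ξ z‖ < ρ ∧ ‖η z‖ < ρ}
  have hξc : Continuous ξ := continuous_iff_continuousAt.2 fun z => (hξa z).continuousAt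
  have hηc : Continuous η := continuous_iff_continuousAt.2 fun z => (hηa z).continuousAt
  have hUo : IsOpen U :=
    (isOpen_lt hξc.norm continuous_const).inter (isOpen_lt hηc.norm continuous_const)
  have hxU : ι x ∈ U := by
    constructor
    · refine ((norm_le hρ0).2 fun t => ?_).trans_lt hρ₀ρ
      rw [hξr, Complex.norm_real]; exact hb t t.2 0
    · refine ((norm_le hρ0).2 fun t => ?_).trans_lt hρ₀ρ
      rw [hηr, Complex.norm_real]; exact hb t t.2 1
  let c : ℕ × ℕ → ℂ := fun p => rising (β : ℂ) p.1 / p.1.factorial *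
    (rising (w : ℂ) p.2 / p.2.factorial)
  let G : ℕ → ℂ × ℂ → (simplexE 2 →ᵇ ℂ) := fun n z =>
    (rising (α : ℂ) n / rising (β + w : ℂ) n) • ∑ p ∈ antidiagonal n, c p • (ξ z ^ p.1 * η z ^ p.2)
  have hGa : ∀ n z, AnalyticAt ℂ (G n) z := fun n z =>
    (analyticAt_const (v := rising (α : ℂ) n / rising (β + w : ℂ) n)).smul
      (Finset.analyticAt_fun_sum _ fun p _ =>
        (analyticAt_const (v := c p)).smul (((hξa z).pow p.1).mul ((hηa z).pow p.2)))
  have hGapp : ∀ n z t, G n z t = rTerm (α : ℂ) β w (ξ z t) (η z t) n := by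
    intro n z t
    simp only [G, rTerm, coe_smul, smul_eq_mul]
    congr 1
    have := map_sum (evalCLM ℂ t) (fun p : ℕ × ℕ => c p • (ξ z ^ p.1 * η z ^ p.2)) (antidiagonal n)
    exact this
  have hGn : ∀ n, ∀ z ∈ U, ‖G n z‖ ≤ u n := by
    intro n z hz
    refine (norm_le ((norm_nonneg _).trans (hbound n 0 0 (by simpa) (by simpa)))).2 fun t => ?_
    rw [hGapp]
    exact hbound n _ _ (((ξ z).norm_coe_le_norm t).trans hz.1.le)
      (((η z).norm_coe_le_norm t).trans hz.2.le)
  have hDi : Integrable (fun t : simplexE 2 => ((dirichletDensity d t : ℝ) : ℂ))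
      (Measure.comap Subtype.val volume) := by
    have := (integrableOn_iff_comap_subtypeVal (measurableSet_simplexE 2)).1
      (integrableOn_dirichletDensity hd)
    exact this.ofReal
  let L := weightedIntegral (Measure.comap Subtype.val volume) _ hDi
  have hΦ : AnalyticOnNhd ℂ (fun z => ∑' n, L (G n z)) U := by
    refine analyticOnNhd_tsum hUo (fun n z _ => (L.analyticAt _).comp (hGa n z)) fun z hz => ?_
    refine ⟨fun n => ‖L‖ * u n, hu.mul_left _, (hUo.eventually_mem hz).mono fun z' hz' n => ?_⟩
    exact (L.le_opNorm _).trans (mul_le_mul_of_nonneg_left (hGn n z' hz') (norm_nonneg _))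
  have hιa : AnalyticAt ℝ ι x :=
    ((Complex.ofRealCLM.analyticAt _).comp analyticAt_fst).prod
      ((Complex.ofRealCLM.analyticAt _).comp analyticAt_snd)
  have hfin : AnalyticAt ℝ (fun x => l ^ (-α) * (∑' n, L (G n (ι x))).re) x := by
    refine analyticAt_const.mul ((Complex.reCLM.analyticAt _).comp ?_)
    exact AnalyticAt.comp (f := ι) (g := fun z => ∑' n, L (G n z))
      ((hΦ _ hxU).restrictScalars) hιa
  refine hfin.congr ?_
  filter_upwards [hιa.continuousAt.eventually_mem (hUo.mem_nhds hxU)] with y hy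
  have hGs : Summable fun n => G n (ι y) :=
    Summable.of_norm_bounded hu fun n => hGn n _ hy
  have hev : ∀ t : simplexE 2, (∑' n, G n (ι y)) t
      = ((∑' n, rTerm α β w (1 - (knots y.1 y.2 *ᵥ bary (t : Fin 2 → ℝ)) 0 / l)
        (1 - (knots y.1 y.2 *ᵥ bary (t : Fin 2 → ℝ)) 1 / l) n : ℝ) : ℂ) := by
    intro t
    have := (evalCLM ℂ t).map_tsum hGs
    rw [Complex.ofReal_tsum]
    refine Eq.trans this (tsum_congr fun n => ?_)
    rw [ofReal_rTerm, ← hξr, ← hηr]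
    exact hGapp n _ t
  have habs : ∀ t ∈ simplexE 2, ∀ i, |1 - (knots y.1 y.2 *ᵥ bary t) i / l| < 1 := by
    intro t ht i
    fin_cases i
    · have := ((ξ (ι y)).norm_coe_le_norm ⟨t, ht⟩).trans_lt (hy.1.trans hρ)
      rwa [hξr, Complex.norm_real] at this
    · have := ((η (ι y)).norm_coe_le_norm ⟨t, ht⟩).trans_lt (hy.2.trans hρ)
      rwa [hηr, Complex.norm_real] at this
  rw [← L.map_tsum hGs]
  simp only [L]
  rw [weightedIntegral_apply]
  simp_rw [hev, ← Complex.ofReal_mul]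
  rw [integral_complex_ofReal]
  rw [Complex.ofReal_re, integral_subtype_comap (measurableSet_simplexE 2) (fun t =>
    (∑' n, rTerm α β w (1 - (knots y.1 y.2 *ᵥ bary t) 0 / l)
        (1 - (knots y.1 y.2 *ᵥ bary t) 1 / l) n) * dirichletDensity d t),
    ← integral_const_mul, knotAverage]
  refine setIntegral_congr_fun (measurableSet_simplexE 2) fun t ht => ?_
  rw [hyperR_eq_tsum hl (habs t ht 0) (habs t ht 1) hβ fun m h => hc m (by rw [h]; ring), mul_assoc]

/-! ### Inversion of the change of variables and identification with F₄ -/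

/-- The discriminant of the quadratic equation that inverts
`(x₁, x₂) ↦ (x₁ (1 - x₂), x₂ (1 - x₁))`. -/
def appellDiscr (p : ℝ × ℝ) : ℝ := (1 - p.1 - p.2) ^ 2 - 4 * p.1 * p.2

/-- The inverse of `(x₁, x₂) ↦ (x₁ (1 - x₂), x₂ (1 - x₁))` with values in `Λ`. -/
def appellInv (p : ℝ × ℝ) : ℝ × ℝ :=
  ((1 + p.1 - p.2 - √(appellDiscr p)) / 2, (1 - p.1 + p.2 - √(appellDiscr p)) / 2)

lemma appellDiscr_apply (x : ℝ × ℝ) :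
    appellDiscr (x.1 * (1 - x.2), x.2 * (1 - x.1)) = (1 - x.1 - x.2) ^ 2 := by
  simp only [appellDiscr]; ring

/-- On Λ the root of the discriminant is 1 - x₁ - x₂ and not its negative; this fixes the branch of
the inverse. -/
lemma appellInv_apply {x : ℝ × ℝ} (hx : x ∈ regionΛ) :
    appellInv (x.1 * (1 - x.2), x.2 * (1 - x.1)) = x := by
  have h : 0 ≤ 1 - x.1 - x.2 := by linarith [hx.2.2]
  rw [appellInv, appellDiscr_apply, Real.sqrt_sq h]
  ext <;> simp only <;> ring

lemma appellInv_spec {p : ℝ × ℝ} (hp : 0 ≤ appellDiscr p) :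
    ((appellInv p).1 * (1 - (appellInv p).2), (appellInv p).2 * (1 - (appellInv p).1)) = p := by
  have h := Real.sq_sqrt hp
  have h' : appellDiscr p = (1 - p.1 - p.2) ^ 2 - 4 * p.1 * p.2 := rfl
  ext <;> simp only [appellInv] <;> linear_combination (-1 / 4) * h - 1 / 4 * h'

lemma appellDiscr_pos_of_mem {p : ℝ × ℝ} (hp : p ∈ domainF4) : 0 < appellDiscr p := by
  obtain ⟨x, hx, rfl⟩ := hp
  rw [appellDiscr_apply]
  have : 0 < 1 - x.1 - x.2 := by linarith [hx.2.2]
  positivity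

lemma appellInv_mem_of_mem {p : ℝ × ℝ} (hp : p ∈ domainF4) : appellInv p ∈ regionΛ := by
  obtain ⟨x, hx, rfl⟩ := hp
  rwa [appellInv_apply hx]

/-- With a = √|p₁| and b = √|p₂|, the discriminant is at least (1-a²-b²)² - 4a²b², whose factors
1-(a+b)² and 1-(a-b)² are positive. -/
lemma mem_domainF4 {p : ℝ × ℝ} (hp : √|p.1| + √|p.2| < 1) : p ∈ domainF4 := by
  have a0 := Real.sqrt_nonneg |p.1|
  have b0 := Real.sqrt_nonneg |p.2|
  have a2 := Real.sq_sqrt (abs_nonneg p.1)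
  have b2 := Real.sq_sqrt (abs_nonneg p.2)
  set a := √|p.1|
  set b := √|p.2|
  have hab : 0 < 1 - a ^ 2 - b ^ 2 - 2 * (a * b) := by nlinarith
  have hab0 : 0 ≤ a * b := mul_nonneg a0 b0
  have h1 : 1 - a ^ 2 - b ^ 2 ≤ 1 - p.1 - p.2 := by
    linarith [le_abs_self p.1, le_abs_self p.2]
  have h2 : p.1 * p.2 ≤ (a * b) ^ 2 := by
    rw [mul_pow, a2, b2, ← abs_mul]; exact le_abs_self _
  have hΔ : 0 < appellDiscr p := by
    rw [appellDiscr]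
    nlinarith
  have hs := Real.sqrt_pos.2 hΔ
  refine ⟨appellInv p, ?_, appellInv_spec hΔ.le⟩
  have h3 := neg_abs_le p.1
  have h4 := neg_abs_le p.2
  have h5 := le_abs_self p.1
  have h6 := le_abs_self p.2
  refine ⟨?_, ?_, ?_⟩ <;> simp only [appellInv] <;> linarith

lemma isPreconnected_domainF4 : IsPreconnected domainF4 := by
  have : Convex ℝ regionΛ := by
    intro x hx y hy a b ha hb hab
    obtain ⟨h1, h2, h3⟩ := hx
    obtain ⟨h4, h5, h6⟩ := hy
    have key : ∀ u v : ℝ, u < 1 → v < 1 → a * u + b * v < 1 := by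
      intro u v hu hv
      rcases ha.eq_or_lt with rfl | ha'
      · have : b = 1 := by linarith
        subst this; linarith
      · nlinarith [mul_pos ha' (sub_pos.2 hu), mul_nonneg hb (sub_pos.2 hv).le]
    refine ⟨key _ _ h1 h4, key _ _ h2 h5, ?_⟩
    have := key _ _ h3 h6
    simp only [Prod.fst_add, Prod.smul_fst, Prod.snd_add, Prod.smul_snd, smul_eq_mul]
    linarith
  exact this.isPreconnected.image _ (by fun_prop)

lemma analyticAt_appellInv {p : ℝ × ℝ} (hp : 0 < appellDiscr p) : AnalyticAt ℝ appellInv p := by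
  have h0 : AnalyticAt ℝ appellDiscr p := by
    have h1 : AnalyticAt ℝ (fun p : ℝ × ℝ => p.1) p := analyticAt_fst
    have h2 : AnalyticAt ℝ (fun p : ℝ × ℝ => p.2) p := analyticAt_snd
    exact (((analyticAt_const (v := (1 : ℝ))).sub h1).sub h2 |>.pow 2).sub
      (((analyticAt_const (v := (4 : ℝ))).mul h1).mul h2)
  have h1 : AnalyticAt ℝ (fun p => √(appellDiscr p)) p :=
    AnalyticAt.comp (g := fun y => √y) (Real.contDiffAt_sqrt hp.ne').analyticAt h0
  have h2 : AnalyticAt ℝ (fun p : ℝ × ℝ => p.1) p := analyticAt_fst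
  have h3 : AnalyticAt ℝ (fun p : ℝ × ℝ => p.2) p := analyticAt_snd
  refine AnalyticAt.prod ?_ ?_
  · exact (((analyticAt_const (v := (1 : ℝ))).add h2).sub h3 |>.sub h1).div
      (analyticAt_const (v := (2 : ℝ))) two_ne_zero
  · exact (((analyticAt_const (v := (1 : ℝ))).sub h2).add h3 |>.sub h1).div
      (analyticAt_const (v := (2 : ℝ))) two_ne_zero

/-- Along the segment from the origin, the sum of the `F₄` series is real-analytic. -/
lemma analyticOnNhd_appellF4_segment {α β γ δ X Y : ℝ} (hγ : ∀ m : ℕ, γ + m ≠ 0)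
    (hδ : ∀ m : ℕ, δ + m ≠ 0) (h : √|X| + √|Y| < 1) :
    AnalyticOnNhd ℝ (fun s : ℝ => ∑' p, appellF4Term α β γ δ (s * X) (s * Y) p)
      (Set.Icc 0 1) := by
  -- Square roots scale by √|s|, so with this k the series still converges for |s| ≤ k², which
  -- covers a neighbourhood of [0, 1].
  obtain ⟨k, hk, hk1⟩ : ∃ k : ℝ, 1 < k ∧ k * (√|X| + √|Y|) < 1 := by
    have h0 : 0 ≤ √|X| + √|Y| := by positivity
    refine ⟨2 / (1 + (√|X| + √|Y|)), ?_, ?_⟩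
    · rw [lt_div_iff₀ (by positivity)]; linarith
    · rw [div_mul_eq_mul_div, div_lt_one (by positivity)]; linarith
  have hk0 : 0 ≤ k := by linarith
  have hscale : ∀ s : ℝ, |s| ≤ k ^ 2 → √|s * X| + √|s * Y| < 1 := by
    intro s hs
    have : √|s| ≤ k := Real.sqrt_le_iff.2 ⟨hk0, hs⟩
    rw [abs_mul, abs_mul, Real.sqrt_mul (abs_nonneg s), Real.sqrt_mul (abs_nonneg s), ← mul_add]
    exact (mul_le_mul_of_nonneg_right this (by positivity)).trans_lt hk1
  have hterm : ∀ (s : ℝ) p, appellF4Term α β γ δ (s * X) (s * Y) p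
      = appellF4Term α β γ δ X Y p * s ^ (p.1 + p.2) := by
    intro s p
    rw [appellF4Term_eq, appellF4Term_eq, mul_pow, mul_pow, pow_add]; ring
  -- Grouping by total degree turns the double series on the ray into a power series in s.
  let c : ℕ → ℝ := fun n => ∑ p ∈ antidiagonal n, appellF4Term α β γ δ X Y p
  have hsum : ∀ s : ℝ, |s| ≤ k ^ 2 → HasSum (fun n => c n * s ^ n)
      (∑' p, appellF4Term α β γ δ (s * X) (s * Y) p) := by
    intro s hs
    have h1 := HasSum.sum_antidiagonal
      (summable_appellF4Term (α := α) (β := β) hγ hδ (hscale s hs)).hasSum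
    refine Eq.mp (congrArg (fun g => HasSum g _) (funext fun n => ?_)) h1
    rw [Finset.sum_mul]
    refine Finset.sum_congr rfl fun p hp => ?_
    rw [hterm, mem_antidiagonal.1 hp]
  have hk2 : 1 < k ^ 2 := by nlinarith
  have habs : Summable fun n => |c n| * (k ^ 2) ^ n := by
    have := (hsum (k ^ 2) (by rw [abs_of_nonneg (by positivity)])).summable.abs
    refine this.congr fun n => ?_
    rw [abs_mul, abs_of_nonneg (by positivity : 0 ≤ (k ^ 2) ^ n)]
  have hF : DifferentiableOn ℂ (fun z : ℂ => ∑' n, (c n : ℂ) * z ^ n) (Metric.ball 0 (k ^ 2)) := by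
    refine Complex.differentiableOn_tsum_of_summable_norm habs
      (fun n => by fun_prop) Metric.isOpen_ball fun n z hz => ?_
    rw [norm_mul, norm_pow, Complex.norm_real, Real.norm_eq_abs]
    rw [mem_ball_zero_iff] at hz
    gcongr
  intro s hs
  have hsb : ((s : ℝ) : ℂ) ∈ Metric.ball (0 : ℂ) (k ^ 2) := by
    rw [mem_ball_zero_iff, Complex.norm_real, Real.norm_eq_abs, abs_of_nonneg hs.1]
    linarith [hs.2]
  have ha : AnalyticAt ℝ (fun s : ℝ => (∑' n, (c n : ℂ) * (s : ℂ) ^ n).re) s := by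
    refine (Complex.reCLM.analyticAt _).comp ?_
    exact AnalyticAt.comp (f := fun s : ℝ => (s : ℂ)) (g := fun z : ℂ => ∑' n, (c n : ℂ) * z ^ n)
      ((hF.analyticAt (Metric.isOpen_ball.mem_nhds hsb)).restrictScalars)
      (Complex.ofRealCLM.analyticAt _)
  refine ha.congr ?_
  have hlt : |s| < k ^ 2 := by rw [abs_of_nonneg hs.1]; linarith [hs.2]
  filter_upwards [(continuous_abs.continuousAt.eventually_lt continuousAt_const hlt)] with r hr
  rw [← (hsum r hr.le).tsum_eq, ← Complex.ofReal_re (∑' n, c n * r ^ n), Complex.ofReal_tsum]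
  simp only [Complex.ofReal_mul, Complex.ofReal_pow]

/-- The average agrees with the F₄ series near the origin. For a general point of the convergence
region, the agreement is carried along the segment from the origin by the identity theorem in one
real variable. -/
theorem isAppellF4_knotAverage {α β γ δ : ℝ} {d : Fin 3 → ℝ} (hd : ∀ i, 0 < d i)
    (hd0 : d 0 = γ + δ - α - 1) (hd01 : d 0 + d 1 = β) (hd012 : d 0 + d 1 + d 2 = δ)
    (hγ : ∀ m : ℕ, γ + m ≠ 0) :
    IsAppellF4 α β γ δ
      (fun p => knotAverage α ![β, γ - β] d (appellInv p).1 (appellInv p).2) := by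
  have hβ : 0 < β := by have := hd 0; have := hd 1; linarith
  have hδ : 0 < δ := by have := hd 2; linarith
  have hδ' : ∀ m : ℕ, δ + m ≠ 0 := fun m => by positivity
  have hγ' : ∀ m : ℕ, β + (γ - β) + m ≠ 0 := fun m => by rw [add_sub_cancel]; exact hγ m
  have han : AnalyticOnNhd ℝ
      (fun p => knotAverage α ![β, γ - β] d (appellInv p).1 (appellInv p).2) domainF4 :=
    fun p hp => AnalyticAt.comp
      (g := fun x : ℝ × ℝ => knotAverage α ![β, γ - β] d x.1 x.2) (f := appellInv)
      (analyticAt_knotAverage hβ hγ' (appellInv_mem_of_mem hp) hd)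
      (analyticAt_appellInv (appellDiscr_pos_of_mem hp))
  refine ⟨han, fun X Y h => ?_⟩
  have hseg : ∀ s ∈ Set.Icc (0 : ℝ) 1, (s * X, s * Y) ∈ domainF4 := by
    intro s hs
    refine mem_domainF4 (lt_of_le_of_lt (add_le_add (Real.sqrt_le_sqrt ?_)
      (Real.sqrt_le_sqrt ?_)) h) <;>
    · rw [abs_mul, abs_of_nonneg hs.1]
      exact mul_le_of_le_one_left (abs_nonneg _) hs.2
  have hlin : ∀ s : ℝ, AnalyticAt ℝ (fun s : ℝ => (s * X, s * Y)) s := fun s =>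
    (analyticAt_id.mul (analyticAt_const (v := X))).prod
      (analyticAt_id.mul (analyticAt_const (v := Y)))
  have hcomp : AnalyticOnNhd ℝ (fun s : ℝ => knotAverage α ![β, γ - β] d
      (appellInv (s * X, s * Y)).1 (appellInv (s * X, s * Y)).2) (Set.Icc 0 1) := fun s hs =>
    AnalyticAt.comp (f := fun s : ℝ => (s * X, s * Y))
      (g := fun p => knotAverage α ![β, γ - β] d (appellInv p).1 (appellInv p).2)
      (han _ (hseg s hs)) (hlin s)
  have heq := hcomp.eqOn_of_preconnected_of_eventuallyEq
    (analyticOnNhd_appellF4_segment (α := α) (β := β) hγ hδ' h) isPreconnected_Icc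
    (Set.left_mem_Icc.2 zero_le_one) ?_ (Set.right_mem_Icc.2 zero_le_one)
  · simp only [one_mul] at heq
    simp only
    rw [heq]
    exact (summable_appellF4Term hγ hδ' h).hasSum
  · have hinv0 : appellInv (0, 0) = 0 := by
      simp [appellInv, appellDiscr]
    have hΔ0 : 0 < appellDiscr (0, 0) := by simp [appellDiscr]
    have hc : Tendsto (fun s : ℝ => appellInv (s * X, s * Y)) (𝓝 0) (𝓝 0) := by
      have h1 : ContinuousAt appellInv ((fun s : ℝ => (s * X, s * Y)) 0) := by
        simp only [zero_mul]; exact (analyticAt_appellInv hΔ0).continuousAt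
      have h2 := (ContinuousAt.comp (f := fun s : ℝ => (s * X, s * Y)) h1
        (hlin 0).continuousAt).tendsto
      simpa [Function.comp_def, hinv0] using h2
    have hcΔ : Tendsto (fun s : ℝ => appellDiscr (s * X, s * Y)) (𝓝 0) (𝓝 1) := by
      have : Continuous (fun s : ℝ => appellDiscr (s * X, s * Y)) := by
        unfold appellDiscr; fun_prop
      simpa [appellDiscr] using this.tendsto 0
    have e1 := (Metric.tendsto_nhds.1 hc) (1 / 10) (by norm_num)
    filter_upwards [e1, hcΔ.eventually (lt_mem_nhds zero_lt_one)] with s hs hΔ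
    rw [dist_zero_right, Prod.norm_def, max_lt_iff] at hs
    rw [knotAverage_eq_tsum hd hd0 hd01 hd012 hγ hs.1.le hs.2.le]
    have := appellInv_spec hΔ.le
    rw [Prod.mk.injEq] at this
    rw [this.1, this.2]

/-- The chosen continuation and the pulled-back average both equal the series near the origin, hence
agree on the connected set `domainF4`. -/
theorem appellF4_eq_knotAverage {α β γ δ : ℝ} {d : Fin 3 → ℝ} (hd : ∀ i, 0 < d i)
    (hd0 : d 0 = γ + δ - α - 1) (hd01 : d 0 + d 1 = β) (hd012 : d 0 + d 1 + d 2 = δ)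
    (hγ : ∀ m : ℕ, γ + m ≠ 0) {x₁ x₂ : ℝ} (hx : (x₁, x₂) ∈ regionΛ) :
    appellF4 α β γ δ (x₁ * (1 - x₂)) (x₂ * (1 - x₁)) = knotAverage α ![β, γ - β] d x₁ x₂ := by
  have hG := isAppellF4_knotAverage hd hd0 hd01 hd012 hγ
  have hE : IsAppellF4 α β γ δ (Classical.epsilon (IsAppellF4 α β γ δ)) :=
    Classical.epsilon_spec ⟨_, hG⟩
  have h0 : ((0 : ℝ), (0 : ℝ)) ∈ domainF4 := mem_domainF4 (by simp)
  have hev : ∀ᶠ p : ℝ × ℝ in 𝓝 (0, 0), √|p.1| + √|p.2| < 1 := by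
    have hc : Continuous fun p : ℝ × ℝ => √|p.1| + √|p.2| := by fun_prop
    exact hc.continuousAt.eventually_lt continuousAt_const (by simp)
  have heq := hE.1.eqOn_of_preconnected_of_eventuallyEq hG.1 isPreconnected_domainF4 h0
    (hev.mono fun p hp => (hE.2 _ _ hp).unique (hG.2 _ _ hp))
    (Set.mem_image_of_mem _ hx)
  simp only [appellInv_apply hx] at heq
  exact heq

/-! ### The spline of a nondegenerate simplex as a transported density -/

section Simplex

variable {s n : ℕ}

/-- The matrix of edge vectors `x^j - x⁰` of the simplex with vertices the columns of `X`. -/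
def edgeMatrix (X : Matrix (Fin s) (Fin (n + 1)) ℝ) : Matrix (Fin s) (Fin n) ℝ :=
  fun i j => X i j.succ - X i 0

lemma mulVec_bary (X : Matrix (Fin s) (Fin (n + 1)) ℝ) (t : Fin n → ℝ) :
    X *ᵥ bary t = (fun i => X i 0) + edgeMatrix X *ᵥ t := by
  ext i
  simp only [Matrix.mulVec, dotProduct, bary, edgeMatrix, Fin.sum_univ_succ, Fin.cons_zero,
    Fin.cons_succ, Pi.add_apply, sub_mul, Finset.sum_sub_distrib, Finset.mul_sum, mul_sub, mul_one]
  ring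

lemma convex_simplexE (n : ℕ) : Convex ℝ (simplexE n) := by
  intro t ht u hu a b ha hb hab
  refine ⟨fun j => ?_, ?_⟩
  · have := ht.1 j
    have := hu.1 j
    simp only [Pi.add_apply, Pi.smul_apply, smul_eq_mul]
    positivity
  · simp only [Pi.add_apply, Pi.smul_apply, smul_eq_mul, Finset.sum_add_distrib, ← Finset.mul_sum]
    calc a * ∑ j, t j + b * ∑ j, u j ≤ a * 1 + b * 1 := by
          gcongr
          · exact ht.2
          · exact hu.2
      _ = 1 := by linarith

lemma hull_eq_image (X : Matrix (Fin s) (Fin (n + 1)) ℝ) :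
    hull X = (fun t => X *ᵥ bary t) '' simplexE n := by
  have hconv : Convex ℝ ((fun t => X *ᵥ bary t) '' simplexE n) := by
    have : (fun t => X *ᵥ bary t) '' simplexE n
        = (fun y => (fun i => X i 0) + y) '' ((edgeMatrix X).mulVecLin '' simplexE n) := by
      rw [Set.image_image]
      exact Set.image_congr fun t _ => mulVec_bary X t
    rw [this]
    exact ((convex_simplexE n).linear_image _).translate _
  refine Set.Subset.antisymm (convexHull_min ?_ hconv) ?_
  · rintro _ ⟨j, rfl⟩
    refine Fin.cases ?_ (fun k => ?_) j
    · refine ⟨0, ⟨fun j => le_rfl, by simp⟩, ?_⟩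
      simp only [mulVec_bary, Matrix.mulVec_zero, add_zero]
    · refine ⟨Pi.single k 1, ⟨fun i => ?_, by simp⟩, ?_⟩
      · by_cases h : i = k
        · subst h; simp
        · simp [h]
      · ext i
        simp [mulVec_bary, edgeMatrix]
  · rintro _ ⟨t, ht, rfl⟩
    have : X *ᵥ bary t = ∑ j, bary t j • (fun i => X i j) := by
      ext i
      simp [Matrix.mulVec, dotProduct, Finset.sum_apply, mul_comm]
    simp only [this]
    exact (convex_convexHull ℝ _).sum_mem (fun j _ => bary_nonneg ht j) (sum_bary t)
      fun j _ => subset_convexHull ℝ _ ⟨j, rfl⟩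

lemma measurableSet_hull (X : Matrix (Fin s) (Fin (n + 1)) ℝ) : MeasurableSet (hull X) := by
  rw [hull_eq_image]
  refine ((isCompact_simplexE n).image ?_).measurableSet
  simp only [mulVec_bary]
  fun_prop

/-- The hull is a translate of the linear image of the standard simplex, so its volume is a multiple
of |det|. -/
lemma det_edgeMatrix_ne_zero {X : Matrix (Fin s) (Fin (s + 1)) ℝ} (h : 0 < volume (hull X)) :
    (edgeMatrix X).det ≠ 0 := by
  intro h0
  refine h.ne' ?_
  have : hull X = (fun y => (fun i => X i 0) + y) ''
      (Matrix.toLin' (edgeMatrix X) '' simplexE s) := by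
    rw [hull_eq_image, Set.image_image]
    exact Set.image_congr fun t _ => mulVec_bary X t
  rw [this, Set.image_add_left, measure_preimage_add, Measure.addHaar_image_linearMap,
    LinearMap.det_toLin', h0]
  simp

lemma injective_mulVec_bary {X : Matrix (Fin s) (Fin (s + 1)) ℝ} (hX : (edgeMatrix X).det ≠ 0) :
    Function.Injective fun t => X *ᵥ bary t := by
  intro t u h
  simp only [mulVec_bary] at h
  exact Matrix.mulVec_injective_of_isUnit
    ((Matrix.isUnit_iff_isUnit_det _).2 (isUnit_iff_ne_zero.2 hX)) (add_left_cancel h)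

lemma hasFDerivAt_mulVec_bary (X : Matrix (Fin s) (Fin (n + 1)) ℝ) (t : Fin n → ℝ) :
    HasFDerivAt (fun t => X *ᵥ bary t)
      (LinearMap.toContinuousLinearMap (Matrix.toLin' (edgeMatrix X))) t := by
  simp only [mulVec_bary]
  exact (LinearMap.toContinuousLinearMap (Matrix.toLin' (edgeMatrix X))).hasFDerivAt.const_add _

lemma det_toContinuousLinearMap_toLin' (A : Matrix (Fin s) (Fin s) ℝ) :
    (LinearMap.toContinuousLinearMap (Matrix.toLin' A)).det = A.det := by
  rw [LinearMap.det_toContinuousLinearMap, LinearMap.det_toLin']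

lemma integrableOn_hull_iff {X : Matrix (Fin s) (Fin (s + 1)) ℝ} (hX : (edgeMatrix X).det ≠ 0)
    (g : (Fin s → ℝ) → ℝ) :
    IntegrableOn g (hull X) ↔
      IntegrableOn (fun t => |(edgeMatrix X).det| * g (X *ᵥ bary t)) (simplexE s) := by
  rw [hull_eq_image, integrableOn_image_iff_integrableOn_abs_det_fderiv_smul volume
    (measurableSet_simplexE s) (fun t _ => (hasFDerivAt_mulVec_bary X t).hasFDerivWithinAt)
    (injective_mulVec_bary hX).injOn]
  simp only [det_toContinuousLinearMap_toLin', smul_eq_mul]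

lemma setIntegral_hull {X : Matrix (Fin s) (Fin (s + 1)) ℝ} (hX : (edgeMatrix X).det ≠ 0)
    (g : (Fin s → ℝ) → ℝ) :
    ∫ y in hull X, g y = ∫ t in simplexE s, |(edgeMatrix X).det| * g (X *ᵥ bary t) := by
  rw [hull_eq_image, integral_image_eq_integral_abs_det_fderiv_smul volume
    (measurableSet_simplexE s) (fun t _ => (hasFDerivAt_mulVec_bary X t).hasFDerivWithinAt)
    (injective_mulVec_bary hX).injOn]
  simp only [det_toContinuousLinearMap_toLin', smul_eq_mul]

/-- The Dirichlet spline of a nondegenerate simplex: the density transported to the simplex. -/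
def simplexSpline (d : Fin (s + 1) → ℝ) (X : Matrix (Fin s) (Fin (s + 1)) ℝ) :
    (Fin s → ℝ) → ℝ :=
  (hull X).indicator fun y =>
    |(edgeMatrix X).det|⁻¹ * dirichletDensity d ((edgeMatrix X)⁻¹ *ᵥ (y - fun i => X i 0))

lemma simplexSpline_apply {X : Matrix (Fin s) (Fin (s + 1)) ℝ} (hX : (edgeMatrix X).det ≠ 0)
    (d : Fin (s + 1) → ℝ) {t : Fin s → ℝ} (ht : t ∈ simplexE s) :
    |(edgeMatrix X).det| * simplexSpline d X (X *ᵥ bary t) = dirichletDensity d t := by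
  have hmem : X *ᵥ bary t ∈ hull X := by
    rw [hull_eq_image]; exact Set.mem_image_of_mem _ ht
  rw [simplexSpline, Set.indicator_of_mem hmem, mul_inv_cancel_left₀ (abs_ne_zero.2 hX),
    mulVec_bary, add_sub_cancel_left, Matrix.mulVec_mulVec,
    Matrix.nonsing_inv_mul _ (isUnit_iff_ne_zero.2 hX), Matrix.one_mulVec]

lemma integrableOn_hull_simplexSpline {X : Matrix (Fin s) (Fin (s + 1)) ℝ}
    (hX : (edgeMatrix X).det ≠ 0) {d : Fin (s + 1) → ℝ} {g : (Fin s → ℝ) → ℝ}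
    (hg : IntegrableOn (fun t => g (X *ᵥ bary t) * dirichletDensity d t) (simplexE s)) :
    IntegrableOn (fun y => g y * simplexSpline d X y) (hull X) := by
  rw [integrableOn_hull_iff hX]
  refine hg.congr_fun (fun t ht => ?_) (measurableSet_simplexE s)
  simp only
  rw [← simplexSpline_apply hX d ht]; ring

lemma setIntegral_hull_simplexSpline {X : Matrix (Fin s) (Fin (s + 1)) ℝ}
    (hX : (edgeMatrix X).det ≠ 0) (d : Fin (s + 1) → ℝ) (g : (Fin s → ℝ) → ℝ) :
    ∫ y in hull X, g y * simplexSpline d X y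
      = ∫ t in simplexE s, g (X *ᵥ bary t) * dirichletDensity d t := by
  rw [setIntegral_hull hX]
  refine setIntegral_congr_fun (measurableSet_simplexE s) fun t ht => ?_
  rw [← simplexSpline_apply hX d ht]; ring

lemma isDirichletSpline_simplexSpline {X : Matrix (Fin s) (Fin (s + 1)) ℝ}
    (hX : (edgeMatrix X).det ≠ 0) {d : Fin (s + 1) → ℝ}
    (hd : IntegrableOn (dirichletDensity d) (simplexE s)) :
    IsDirichletSpline d X (simplexSpline d X) := by
  constructor
  · refine Integrable.locallyIntegrable ?_
    have h := integrableOn_hull_simplexSpline (d := d) (g := fun _ => 1) hX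
      (by simpa only [one_mul] using hd)
    simp only [one_mul] at h
    have h' := h.integrable_indicator (measurableSet_hull X)
    rwa [simplexSpline, Set.indicator_indicator, Set.inter_self] at h'
  · intro f _ _
    rw [← setIntegral_hull_simplexSpline hX, setIntegral_eq_integral_of_forall_compl_eq_zero]
    intro y hy
    rw [simplexSpline, Set.indicator_of_notMem hy, mul_zero]

/-- A locally integrable function is determined almost everywhere by its integrals against smooth
compactly supported functions, so the chosen version agrees with the explicit density. -/
lemma spline_ae_eq {X : Matrix (Fin s) (Fin (s + 1)) ℝ}
    (hX : (edgeMatrix X).det ≠ 0) {d : Fin (s + 1) → ℝ}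
    (hd : IntegrableOn (dirichletDensity d) (simplexE s)) :
    spline d X =ᵐ[volume] simplexSpline d X := by
  have h1 := isDirichletSpline_simplexSpline hX hd
  have h2 : IsDirichletSpline d X (spline d X) := Classical.epsilon_spec ⟨_, h1⟩
  refine ae_eq_of_integral_contDiff_smul_eq h2.1 h1.1 fun g hg hgc => ?_
  simp only [smul_eq_mul]
  rw [h1.2 g hg.continuous hgc, h2.2 g hg.continuous hgc]

end Simplex

/-! ### Conclusion -/

lemma pos_of_mem_hull_knots {x : ℝ × ℝ} (hx : x ∈ regionΛ) {y : Fin 2 → ℝ}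
    (hy : y ∈ hull (knots x.1 x.2)) (i : Fin 2) : 0 < y i := by
  have : Convex ℝ {y : Fin 2 → ℝ | 0 < y i} :=
    convex_halfSpace_gt (LinearMap.proj (R := ℝ) (φ := fun _ : Fin 2 => ℝ) i).isLinear 0
  refine convexHull_min ?_ this hy
  rintro _ ⟨j, rfl⟩
  exact knots_pos hx i j

lemma integral_hull_spline_mul_hyperR {x₁ x₂ α β γ δ : ℝ} (hx : (x₁, x₂) ∈ regionΛ)
    (hvol : 0 < volume (hull (knots x₁ x₂))) {d : Fin 3 → ℝ} (hd : ∀ i, 0 < d i)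
    (hd0 : d 0 = γ + δ - α - 1) (hd01 : d 0 + d 1 = β) (hd012 : d 0 + d 1 + d 2 = δ)
    (hγ : ∀ m : ℕ, γ ≠ -(m : ℝ)) :
    IntegrableOn (fun y => spline d (knots x₁ x₂) y * hyperR α ![β, γ - β] y)
      (hull (knots x₁ x₂)) ∧
    appellF4 α β γ δ (x₁ * (1 - x₂)) (x₂ * (1 - x₁)) =
      ∫ y in hull (knots x₁ x₂), spline d (knots x₁ x₂) y * hyperR α ![β, γ - β] y := by
  have hX := det_edgeMatrix_ne_zero hvol
  have hβ : 0 < β := by have := hd 0; have := hd 1; linarith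
  have hγ' : ∀ m : ℕ, γ + m ≠ 0 := fun m h => hγ m (by linarith)
  have hγ'' : ∀ m : ℕ, β + (γ - β) + m ≠ 0 := fun m => by rw [add_sub_cancel]; exact hγ' m
  have hae : (fun y => hyperR α ![β, γ - β] y * simplexSpline d (knots x₁ x₂) y)
      =ᵐ[volume.restrict (hull (knots x₁ x₂))]
      fun y => spline d (knots x₁ x₂) y * hyperR α ![β, γ - β] y := by
    filter_upwards [ae_restrict_of_ae (spline_ae_eq hX (integrableOn_dirichletDensity hd))]
      with y hy
    rw [hy, mul_comm]
  refine ⟨(integrableOn_hull_simplexSpline hX (integrableOn_hyperR_knots hβ hγ'' hx hd)).congr hae,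
    ?_⟩
  rw [← integral_congr_ae hae, setIntegral_hull_simplexSpline hX,
    appellF4_eq_knotAverage hd hd0 hd01 hd012 hγ' hx, knotAverage]

/-- On the hull both coordinates are positive and `hyperR_self` gives the monomial. Outside it the
real powers may have nonpositive bases, but the spline vanishes almost everywhere there, so their
values do not matter. -/
lemma momentIntegrand_ae_eq {x₁ x₂ α β : ℝ} (hx : (x₁, x₂) ∈ regionΛ)
    (hvol : 0 < volume (hull (knots x₁ x₂))) {d : Fin 3 → ℝ} (hd : ∀ i, 0 < d i)
    (hβ : 0 < β) (hα : ∀ m : ℕ, α ≠ -(m : ℝ)) :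
    momentIntegrand (-![β, α - β]) d (knots x₁ x₂) =ᵐ[volume]
      (hull (knots x₁ x₂)).indicator
        fun y => spline d (knots x₁ x₂) y * hyperR α ![β, α - β] y := by
  filter_upwards [spline_ae_eq (det_edgeMatrix_ne_zero hvol) (integrableOn_dirichletDensity hd)]
    with y hy
  by_cases h : y ∈ hull (knots x₁ x₂)
  · have hp := pos_of_mem_hull_knots hx h
    rw [Set.indicator_of_mem h, momentIntegrand, Fin.prod_univ_two,
      hyperR_self (hp 0) (hp 1) hβ (by ring) hα]
    simp only [Pi.neg_apply, Matrix.cons_val_zero, Matrix.cons_val_one]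
    ring
  · rw [Set.indicator_of_notMem h, momentIntegrand, hy, simplexSpline,
      Set.indicator_of_notMem h, mul_zero]

end DirichletSpline

end

open DirichletSpline in
theorem corollary6p3 (x₁ x₂ : ℝ) (hx : (x₁, x₂) ∈ regionΛ)
    (hvol : 0 < volume (hull (knots x₁ x₂))) :
    (∀ (α β γ δ : ℝ) (d : Fin 3 → ℝ) (b : Fin 2 → ℝ),
      (∀ m : ℕ, γ ≠ -(m : ℝ)) →
      d = ![γ + δ - α - 1, α + β - γ - δ + 1, δ - β] →
      (∀ i, 0 < d i) →
      b = ![β, γ - β] →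
      IntegrableOn (fun y => spline d (knots x₁ x₂) y * hyperR α b y) (hull (knots x₁ x₂)) ∧
      appellF4 α β γ δ (x₁ * (1 - x₂)) (x₂ * (1 - x₁)) =
        ∫ y in hull (knots x₁ x₂), spline d (knots x₁ x₂) y * hyperR α b y) ∧
    (∀ (α β δ : ℝ) (d : Fin 3 → ℝ) (b : Fin 2 → ℝ),
      (∀ m : ℕ, α ≠ -(m : ℝ)) →
      d = ![δ - 1, β - δ + 1, δ - β] →
      (∀ i, 0 < d i) →
      b = ![β, α - β] →
      Integrable (momentIntegrand (-b) d (knots x₁ x₂)) ∧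
      appellF4 α β α δ (x₁ * (1 - x₂)) (x₂ * (1 - x₁)) = moment (-b) d (knots x₁ x₂)) := by
  constructor
  · rintro α β γ δ d b hγ hdef hd rfl
    refine integral_hull_spline_mul_hyperR hx hvol hd ?_ ?_ ?_ hγ <;>
      simp only [hdef, Matrix.cons_val_zero, Matrix.cons_val_one, Matrix.cons_val_two,
        Matrix.head_cons, Matrix.tail_cons] <;> ring
  · rintro α β δ d b hα hdef hd rfl
    have h01 : d 0 + d 1 = β := by simp [hdef]
    have hβ : 0 < β := by have := hd 0; have := hd 1; linarith
    -- For γ = α the parameters d of part (i) reduce to those of part (ii).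
    obtain ⟨hi, he⟩ := integral_hull_spline_mul_hyperR (α := α) (γ := α) (δ := δ) hx hvol hd
      (by simp [hdef]) h01 (by simp [hdef]) hα
    have hae := momentIntegrand_ae_eq hx hvol hd hβ hα
    refine ⟨(hi.integrable_indicator (measurableSet_hull _)).congr hae.symm, ?_⟩
    rw [he, moment, integral_congr_ae hae, integral_indicator (measurableSet_hull _)]
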